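/- Let $\mathbb S^2$ be the unit sphere (curvature $1$) and $\mathbb H^2$ the hyperbolic plane of curvature $-1$, and equip $\mathbb S^2\times\mathbb H^2$ with the product metric $\langle\cdot,\cdot\rangle$, with projections $\pi_1,\pi_2$ onto the factors and product structure $F(v_1,v_2)=(v_1,-v_2)$. Let $\Sigma$ be a smooth surface and $\Phi\colon\Sigma\to\mathbb S^2\times\mathbb H^2$ a smooth immersion; give $\Sigma$ the induced metric, and let $h$ be the second fundamental form, $H=\tfrac12\operatorname{tr}h$ the mean curvature vector field and $\nabla^\perp$ the normal connection of $\Phi$. Assume that $\Phi$ is a PMC surface, that is, $\nabla^\perp H=0$ and $H$ is nowhere zero. Assume moreover that its Hopf differential $$\Theta=\bigl(4\langle h(\partial_z,\partial_z),H\rangle+\langle F\partial_z,\partial_z\rangle\bigr)\,dz\otimes dz ,$$ vanishes identically; here $z=x+iy$ is any local conformal coordinate, $\partial_z=\tfrac12(\partial_x-i\partial_y)$, and $h$, $F$ and $\langle\cdot,\cdot\rangle$ are extended complex (bi)linearly. (Equivalently, $4\langle h(\zeta,\zeta),H\rangle+\langle F\zeta,\zeta\rangle=0$ for every $p\in\Sigma$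 and every $\zeta=\tfrac12(v-iw)$, where $v,w\in T_p\Sigma$ are orthogonal and of equal length.) Then for every $p\in\Sigma$, identifying $T_p\Sigma$ with $d\Phi_p(T_p\Sigma)$ and writing $\pi_i(p)$ for $\pi_i(\Phi(p))$, $$T_p\Sigma\cap\bigl(T_{\pi_1(p)}\mathbb S^2\times\{0\}\bigr)\neq\{0\}\qquad\text{or}\qquad T_p\Sigma\cap\bigl(\{0\}\times T_{\pi_2(p)}\mathbb H^2\bigr)\neq\{0\}.$$ -/

import Mathlib

open scoped Manifold ContDiff

noncomputable section

namespace S2H2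

/-! The product `𝕊² × ℍ²` in `ℝ³ × ℝ³₁` (hyperboloid model of `ℍ²`). -/

/-- The flat space `ℝ³ × ℝ³₁`. -/
abbrev V : Type := (Fin 3 → ℝ) × (Fin 3 → ℝ)

/-- The Minkowski product of `ℝ³₁`, the last coordinate being timelike. -/
def mink (b d : Fin 3 → ℝ) : ℝ := b 0 * d 0 + b 1 * d 1 - b 2 * d 2

/-- The scalar product of `ℝ³ × ℝ³₁`. It is positive definite on the tangent spaces of `𝕊² × ℍ²`,
and its restriction to them is the product metric of `𝕊² × ℍ²`. -/
def ip (u w : V) : ℝ := dotProduct u.1 w.1 + mink u.2 w.2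

/-- The unit sphere `𝕊²`, of Gaussian curvature `1`. -/
def sphere : Set (Fin 3 → ℝ) := {a | dotProduct a a = 1}

/-- The hyperbolic plane `ℍ²`, of Gaussian curvature `-1`: the upper sheet of the hyperboloid. -/
def hyp : Set (Fin 3 → ℝ) := {b | mink b b = -1 ∧ 0 < b 2}

/-- The tangent plane `T_a 𝕊²`. -/
def tangentSphere (a : Fin 3 → ℝ) : Submodule ℝ (Fin 3 → ℝ) where
  carrier := {v | dotProduct a v = 0}
  add_mem' := by
    intro v w hv hw
    simp only [Set.mem_ofPred_eq] at hv hw ⊢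
    rw [dotProduct_add, hv, hw, add_zero]
  zero_mem' := by simp
  smul_mem' := by
    intro c v hv
    simp only [Set.mem_ofPred_eq] at hv ⊢
    rw [dotProduct_smul, hv, smul_zero]

/-- The tangent plane `T_b ℍ²`. -/
def tangentHyp (b : Fin 3 → ℝ) : Submodule ℝ (Fin 3 → ℝ) where
  carrier := {w | mink b w = 0}
  add_mem' := by
    intro v w hv hw
    simp only [Set.mem_ofPred_eq, mink, Pi.add_apply] at hv hw ⊢
    linarith
  zero_mem' := by simp [mink]
  smul_mem' := by
    intro c v hv
    simp only [Set.mem_ofPred_eq, mink, Pi.smul_apply, smul_eq_mul] at hv ⊢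
    linear_combination c * hv

/-- The product structure `F (v₁, v₂) = (v₁, -v₂)`. -/
def prodStr (u : V) : V := (u.1, -u.2)

/-- The orthogonal projection of `ℝ³ × ℝ³₁` onto `T_P (𝕊² × ℍ²)`, for `P` in `𝕊² × ℍ²`. -/
def ambProj (P u : V) : V :=
  (u.1 - dotProduct P.1 u.1 • P.1, u.2 + mink P.2 u.2 • P.2)

/-! Geometry of a local parametrization `X : ℝ² ⊇ U → 𝕊² × ℍ²` of an immersed surface at a
point `x` of the open set `U`. A vector `v : ℝ²` stands for the tangent vector `dX_x v`, and the
surface carries the induced metric. -/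

/-- The coordinate plane `ℝ²`. -/
abbrev E2 : Type := EuclideanSpace ℝ (Fin 2)

/-- The coordinate vector `∂_i` of `ℝ²`. -/
def basisVec (i : Fin 2) : E2 := EuclideanSpace.single i 1

/-- The induced metric (first fundamental form). -/
def metric (X : E2 → V) (x v w : E2) : ℝ := ip (fderiv ℝ X x v) (fderiv ℝ X x w)

/-- The matrix `(g_ij)` of the induced metric. -/
def gram (X : E2 → V) (x : E2) : Matrix (Fin 2) (Fin 2) ℝ :=
  Matrix.of fun i j => metric X x (basisVec i) (basisVec j)

/-- The component tangent to the surface of an ambient vector `u`: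
`∑ g^ij ⟨u, ∂_i X⟩ ∂_j X`. -/
def tanPart (X : E2 → V) (x : E2) (u : V) : V :=
  ∑ i, ∑ j, ((gram X x)⁻¹ i j * ip u (fderiv ℝ X x (basisVec i))) •
    fderiv ℝ X x (basisVec j)

/-- The component normal to the surface of a tangent vector `u` of `𝕊² × ℍ²`. -/
def norPart (X : E2 → V) (x : E2) (u : V) : V := u - tanPart X x u

/-- The covariant derivative `∇̃_v Y`, for the Levi-Civita connection of `𝕊² × ℍ²`, of a field `Y`
of tangent vectors of `𝕊² × ℍ²` along `X`: the tangential component of the flat derivative. -/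
def covDeriv (X Y : E2 → V) (x v : E2) : V := ambProj (X x) (fderiv ℝ Y x v)

/-- The second fundamental form `h(v, w)`: by the formula of Gauss, the normal component of
`∇̃_v (dX w)`, with `w` extended to a constant field on the coordinate plane. -/
def secondFF (X : E2 → V) (x v w : E2) : V :=
  norPart X x (covDeriv X (fun y => fderiv ℝ X y w) x v)

/-- The mean curvature vector `H = (1/2) tr h`. -/
def meanCurv (X : E2 → V) (x : E2) : V :=
  (1 / 2 : ℝ) • ∑ i, ∑ j, (gram X x)⁻¹ i j • secondFF X x (basisVec i) (basisVec j)

/-- The derivative `∇^⊥_v H` of the mean curvature vector in the normal bundle. -/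
def normalDerivMeanCurv (X : E2 → V) (x v : E2) : V :=
  norPart X x (covDeriv X (meanCurv X) x v)

/-- The complex bilinear extension of a real bilinear form `B` on `ℝ²`; the pair `(a, b)` stands
for the complexified tangent vector `a + i b`. -/
def complexBilin (B : E2 → E2 → ℝ) (z w : E2 × E2) : ℂ :=
  ⟨B z.1 w.1 - B z.2 w.2, B z.1 w.2 + B z.2 w.1⟩

/-- The complexified tangent vector `(v - i w) / 2`, which is `∂_z` if `v = ∂_x` and `w = ∂_y`. -/
def dz (v w : E2) : E2 × E2 := ((1 / 2 : ℝ) • v, -(1 / 2 : ℝ) • w)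

/-- The values `v` and `w` at the point `x` of `∂_x` and `∂_y` for conformal coordinates: two
orthogonal tangent vectors of the same length. -/
def IsConformalPair (X : E2 → V) (x v w : E2) : Prop :=
  metric X x v v = metric X x w w ∧ metric X x v w = 0

/-- The value `4 ⟨h(∂_z, ∂_z), H⟩ + ⟨F ∂_z, ∂_z⟩` of the Hopf differential `Θ` at `x` on the
vector `∂_z = (v - i w) / 2`. -/
def hopf (X : E2 → V) (x v w : E2) : ℂ :=
  4 * complexBilin (fun a b => ip (secondFF X x a b) (meanCurv X x)) (dz v w) (dz v w) +
    complexBilin (fun a b => ip (prodStr (fderiv ℝ X x a)) (fderiv ℝ X x b)) (dz v w) (dz v w)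

/-! Immersed surfaces in `𝕊² × ℍ²`. -/

variable {S : Type*} [TopologicalSpace S] [ChartedSpace E2 S]

/-- `Φ` is a smooth immersion of the surface `S` into `𝕊² × ℍ²`. -/
structure IsImmersedSurface (Φ : S → V) : Prop where
  mem_sphere : ∀ p, (Φ p).1 ∈ sphere
  mem_hyp : ∀ p, (Φ p).2 ∈ hyp
  smooth : ContMDiff (𝓡 2) 𝓘(ℝ, V) ∞ Φ
  injective_mfderiv : ∀ p, Function.Injective (mfderiv (𝓡 2) 𝓘(ℝ, V) Φ p)

/-- A PMC surface: an immersed surface with `∇^⊥ H = 0` and `H ≠ 0`, expressed in the charts. -/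
structure IsPMC (Φ : S → V) : Prop extends IsImmersedSurface Φ where
  parallel : ∀ e ∈ atlas E2 S, ∀ x ∈ e.target, ∀ v : E2,
    normalDerivMeanCurv (Φ ∘ e.symm) x v = 0
  ne_zero : ∀ e ∈ atlas E2 S, ∀ x ∈ e.target, meanCurv (Φ ∘ e.symm) x ≠ 0

/-- The Hopf differential vanishes identically. As a quadratic differential, `Θ` is determined at
each point by its value on `∂_z` for one conformal coordinate `z` there, hence by its values on the
vectors `(v - i w) / 2` with `(v, w)` a conformal pair. No orientation is fixed: replacing `w` by
`-w` conjugates the value. -/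
def HopfVanishes (Φ : S → V) : Prop :=
  ∀ e ∈ atlas E2 S, ∀ x ∈ e.target, ∀ v w : E2,
    IsConformalPair (Φ ∘ e.symm) x v w → hopf (Φ ∘ e.symm) x v w = 0

/-- The tangent plane `T_p S`, as the subspace `dΦ_p (T_p S)` of `ℝ³ × ℝ³₁`. -/
def tangentPlane (Φ : S → V) (p : S) : Submodule ℝ V :=
  LinearMap.range (show E2 →L[ℝ] V from mfderiv (𝓡 2) 𝓘(ℝ, V) Φ p).toLinearMap

end S2H2

end

noncomputable section

namespace S2H2

/-! ### Orthogonal expansions -/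

/-! Suppose that no tangent vector at some point is tangent to a factor. Then the metrics pulled
back from `𝕊²` and `ℍ²` are both positive definite near that point, and on some nonempty open set a
smooth frame `v₁, v₂` diagonalizes both (`exists_diagonal`). Let `A`, `B` be the eigenvalues of the
tangential part of `F`, with `A ^ 2, B ^ 2 < 1`. With the right scaling, `ν₁ = F v₁ - A v₁` and `ν₂
= F v₂ - B v₂` form an orthonormal normal frame, and `H = x ν₁ - y ν₂`. The open set can be chosen
so that either `A = B` throughout or `A ≠ B` throughout. In the first case `H = 0`
(`eq_zero_of_eq`), which is excluded.

Let `A ≠ B`. A parallel nonzero section of a normal bundle of rank two makes that bundle flat. The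
normal connection form is the sum of the suitably normalized connection forms of the two factors; in
the sum of their Gauss equations the curvatures `1` and `-1` cancel, and flatness says that the
trace-free shape operators commute. Together with `Θ = 0` this makes `h` diagonal in the frame,
which is to say `D₂ A = D₁ B = 0` (`deriv_eq_zero`).

Write `L = A - B` and `h(e₁, e₁) - H = N ν₁ + M ν₂`, with `e₁` the unit vector along `v₁`. The first
derivatives of `L, x, y, M, N` are then rational functions of these quantities (`IsHopfSystem`). The
bracket relation on `M` and `N` yields the integrability condition `M ^ 2 - N ^ 2 = y M - x N`
(`quadratic`), so `L = 8 (M ^ 2 - N ^ 2)`. One more differentiation forces `49 L ^ 2 = 144 (x ^ 2 +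
y ^ 2) ^ 2` and makes one derivative of `L` nonzero at each point (`ratio_of_relations`). But `x ^ 2
+ y ^ 2 = |H| ^ 2` is constant, a contradiction.

The calculation takes place in a commutative ring with derivations and a separating family of
evaluations: identities are differentiated in the ring, and divisions are made after evaluation at a
point. -/

theorem eq_sum_of_orthogonal {ι W : Type*} [Fintype ι] [AddCommGroup W] [Module ℝ W]
    [FiniteDimensional ℝ W] (B : LinearMap.BilinForm ℝ W) (e : ι → W)
    (hcard : Fintype.card ι = Module.finrank ℝ W) (horth : ∀ i j, i ≠ j → B (e i) (e j) = 0)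
    (hne : ∀ i, B (e i) (e i) ≠ 0) (w : W) :
    w = ∑ i, (B w (e i) / B (e i) (e i)) • e i := by
  classical
  have hli : LinearIndependent ℝ e :=
    LinearMap.BilinForm.linearIndependent_of_iIsOrtho (B := B) (fun i j hij => horth i j hij)
      (fun i => hne i)
  let b := basisOfLinearIndependentOfCardEqFinrank' e hli hcard
  have hb : ∀ i, b i = e i := fun i => by simp [b]
  conv_lhs => rw [← b.sum_repr w]
  refine Finset.sum_congr rfl fun i _ => ?_
  rw [hb]
  congr 1
  rw [eq_div_iff (hne i)]
  conv_rhs => rw [← b.sum_repr w]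
  simp only [map_sum, LinearMap.sum_apply, map_smul, LinearMap.smul_apply, smul_eq_mul, hb]
  rw [Finset.sum_eq_single i]
  · intro j _ hj
    rw [horth j i hj, mul_zero]
  · simp

/-! ### Quadratic forms on triples -/

section Form

variable {R : Type*} [CommRing R] [Algebra ℝ R]

/-- The bilinear form with diagonal coefficients `1, 1, σ`. -/
def qf (σ : ℝ) (u w : Fin 3 → R) : R := u 0 * w 0 + u 1 * w 1 + σ • (u 2 * w 2)

theorem qf_one (u w : Fin 3 → ℝ) : qf 1 u w = dotProduct u w := by
  simp [qf, dotProduct, Fin.sum_univ_three]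

theorem qf_neg_one (u w : Fin 3 → ℝ) : qf (-1) u w = mink u w := by
  simp [qf, mink, sub_eq_add_neg]

theorem qf_comm (σ : ℝ) (u w : Fin 3 → R) : qf σ u w = qf σ w u := by
  simp only [qf, mul_comm]

theorem qf_add_left (σ : ℝ) (u v w : Fin 3 → R) : qf σ (u + v) w = qf σ u w + qf σ v w := by
  simp only [qf, Pi.add_apply, add_mul, smul_add]; ring

theorem qf_sub_left (σ : ℝ) (u v w : Fin 3 → R) : qf σ (u - v) w = qf σ u w - qf σ v w := by
  simp only [qf, Pi.sub_apply, sub_mul, smul_sub]; ring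

theorem qf_smul_left (σ : ℝ) (c : R) (u w : Fin 3 → R) : qf σ (c • u) w = c * qf σ u w := by
  simp only [qf, Pi.smul_apply, smul_eq_mul, Algebra.smul_def]; ring

theorem qf_smul_right (σ : ℝ) (c : R) (u w : Fin 3 → R) : qf σ u (c • w) = c * qf σ u w := by
  rw [qf_comm, qf_smul_left, qf_comm]

theorem map_qf {S : Type*} [CommRing S] [Algebra ℝ S] (φ : R →ₐ[ℝ] S) (σ : ℝ)
    (u w : Fin 3 → R) : φ (qf σ u w) = qf σ (φ ∘ u) (φ ∘ w) := by
  simp [qf]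

/-- The form `qf` on `ℝ³` as a bilinear form. -/
def qfBilin (σ : ℝ) : LinearMap.BilinForm ℝ (Fin 3 → ℝ) :=
  LinearMap.mk₂ ℝ (qf σ) (qf_add_left σ) (fun c u w => qf_smul_left σ c u w)
    (fun u v w => by rw [qf_comm, qf_add_left, qf_comm σ v, qf_comm σ w])
    (fun c u w => qf_smul_right σ c u w)

@[simp] theorem qfBilin_apply (σ : ℝ) (u w : Fin 3 → ℝ) : qfBilin σ u w = qf σ u w := rfl

theorem eq_sum_of_qf_orthogonal {σ : ℝ} {a e f : Fin 3 → ℝ} (hae : qf σ a e = 0)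
    (haf : qf σ a f = 0) (hef : qf σ e f = 0) (ha : qf σ a a ≠ 0) (he : qf σ e e ≠ 0)
    (hf : qf σ f f ≠ 0) (u : Fin 3 → ℝ) :
    u = (qf σ u a / qf σ a a) • a + (qf σ u e / qf σ e e) • e + (qf σ u f / qf σ f f) • f := by
  have hea : qf σ e a = 0 := by rw [qf_comm, hae]
  have hfa : qf σ f a = 0 := by rw [qf_comm, haf]
  have hfe : qf σ f e = 0 := by rw [qf_comm, hef]
  have := eq_sum_of_orthogonal (qfBilin σ) ![a, e, f] (by simp)
    (by intro i j hij; fin_cases i <;> fin_cases j <;> simp_all)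
    (by intro i; fin_cases i <;> simp_all) u
  simpa [Fin.sum_univ_three] using this

theorem qf_parseval {σ : ℝ} {a e f : Fin 3 → ℝ} (hae : qf σ a e = 0)
    (haf : qf σ a f = 0) (hef : qf σ e f = 0) (ha : qf σ a a ≠ 0) (he : qf σ e e ≠ 0)
    (hf : qf σ f f ≠ 0) (u w : Fin 3 → ℝ) :
    qf σ u w = qf σ u a * qf σ w a / qf σ a a + qf σ u e * qf σ w e / qf σ e e +
      qf σ u f * qf σ w f / qf σ f f := by
  conv_lhs => rw [eq_sum_of_qf_orthogonal hae haf hef ha he hf u]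
  rw [qf_add_left, qf_add_left, qf_smul_left, qf_smul_left, qf_smul_left, qf_comm σ a w,
    qf_comm σ e w, qf_comm σ f w]
  ring

/-- Componentwise application of a derivation. -/
def dvec (D : Derivation ℝ R R) (u : Fin 3 → R) : Fin 3 → R := fun k => D (u k)

theorem derivation_qf (D : Derivation ℝ R R) (σ : ℝ) (u w : Fin 3 → R) :
    D (qf σ u w) = qf σ (dvec D u) w + qf σ u (dvec D w) := by
  simp only [qf, dvec, map_add, Derivation.leibniz, Derivation.map_smul, smul_eq_mul, smul_add,
    mul_comm]
  ring

theorem dvec_smul (D : Derivation ℝ R R) (c : R) (u : Fin 3 → R) :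
    dvec D (c • u) = D c • u + c • dvec D u := by
  ext k
  simp only [dvec, Pi.smul_apply, Pi.add_apply, smul_eq_mul, Derivation.leibniz]
  ring

theorem dvec_sub (D : Derivation ℝ R R) (u w : Fin 3 → R) :
    dvec D (u - w) = dvec D u - dvec D w := by
  ext k; simp [dvec]

theorem dvec_bracket {D₁ D₂ : Derivation ℝ R R} {α β : R}
    (hcomm : ∀ f, D₁ (D₂ f) - D₂ (D₁ f) = α * D₁ f + β * D₂ f) (u : Fin 3 → R) :
    dvec D₁ (dvec D₂ u) = dvec D₂ (dvec D₁ u) + α • dvec D₁ u + β • dvec D₂ u := by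
  ext k
  simp only [dvec, Pi.add_apply, Pi.smul_apply, smul_eq_mul]
  linear_combination hcomm (u k)

end Form

/-! ### A surface with a moving frame -/

section Frame

variable {ι R : Type*} [CommRing R] [Algebra ℝ R] {ev : ι → R →ₐ[ℝ] ℝ}
  {D₁ D₂ : Derivation ℝ R R} {α β : R} {σ : ℝ} {a : Fin 3 → R} {A B : R}

/-- The map `a` to the quadric `qf σ a a = σ` is, for the commuting relation
`[D₁, D₂] = α D₁ + β D₂`, an immersion for which `D₁, D₂` are orthogonal of squared lengths
`1 / (2 (1 - σ A))` and `1 / (2 (1 - σ B))`. -/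
structure IsQuadricFrame (ev : ι → R →ₐ[ℝ] ℝ) (D₁ D₂ : Derivation ℝ R R) (α β : R) (σ : ℝ)
    (a : Fin 3 → R) (A B : R) : Prop where
  ext_ev : ∀ f g : R, (∀ i, ev i f = ev i g) → f = g
  bracket : ∀ f, D₁ (D₂ f) - D₂ (D₁ f) = α * D₁ f + β * D₂ f
  sigma_ne : σ ≠ 0
  quadric : qf σ a a = algebraMap ℝ R σ
  orth : qf σ (dvec D₁ a) (dvec D₂ a) = 0
  norm₁ : 2 * (1 - σ • A) * qf σ (dvec D₁ a) (dvec D₁ a) = 1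
  norm₂ : 2 * (1 - σ • B) * qf σ (dvec D₂ a) (dvec D₂ a) = 1

namespace IsQuadricFrame

/-- The normalization is a product equal to `1`, so no factor of it vanishes at any point. This
licenses all later divisions after evaluation. -/
theorem ev_ne₁ (h : IsQuadricFrame ev D₁ D₂ α β σ a A B) (i : ι) : 1 - σ * ev i A ≠ 0 := by
  intro h0
  have := congrArg (ev i) h.norm₁
  simp [h0] at this

theorem ev_ne₂ (h : IsQuadricFrame ev D₁ D₂ α β σ a A B) (i : ι) : 1 - σ * ev i B ≠ 0 := by
  intro h0
  have := congrArg (ev i) h.norm₂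
  simp [h0] at this

theorem ev_norm₁ (h : IsQuadricFrame ev D₁ D₂ α β σ a A B) (i : ι) :
    ev i (qf σ (dvec D₁ a) (dvec D₁ a)) = 1 / (2 * (1 - σ * ev i A)) := by
  have := congrArg (ev i) h.norm₁
  have h0 := h.ev_ne₁ i
  simp only [map_mul, map_sub, map_one, map_smul, smul_eq_mul, map_ofNat] at this
  field_simp
  linarith

theorem ev_norm₂ (h : IsQuadricFrame ev D₁ D₂ α β σ a A B) (i : ι) :
    ev i (qf σ (dvec D₂ a) (dvec D₂ a)) = 1 / (2 * (1 - σ * ev i B)) := by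
  have := congrArg (ev i) h.norm₂
  have h0 := h.ev_ne₂ i
  simp only [map_mul, map_sub, map_one, map_smul, smul_eq_mul, map_ofNat] at this
  field_simp
  linarith

theorem ev_deriv_norm₁ (h : IsQuadricFrame ev D₁ D₂ α β σ a A B) (D : Derivation ℝ R R) (i : ι) :
    ev i (qf σ (dvec D (dvec D₁ a)) (dvec D₁ a)) =
      σ * ev i (D A) / (4 * (1 - σ * ev i A) ^ 2) := by
  have h1 := congrArg (fun f => ev i (D f)) h.norm₁
  have h0 := h.ev_ne₁ i
  have h2 : D (2 : R) = 0 := by simpa using D.map_natCast 2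
  simp only [Derivation.leibniz, map_sub, Derivation.map_one_eq_zero, Derivation.map_smul,
    smul_eq_mul, map_add, map_mul, map_one, map_smul, map_ofNat, h2, derivation_qf,
    qf_comm σ (dvec D₁ a) (dvec D (dvec D₁ a)), h.ev_norm₁, map_zero] at h1
  field_simp at h1 ⊢
  linear_combination h1 / 2

theorem ev_deriv_norm₂ (h : IsQuadricFrame ev D₁ D₂ α β σ a A B) (D : Derivation ℝ R R) (i : ι) :
    ev i (qf σ (dvec D (dvec D₂ a)) (dvec D₂ a)) =
      σ * ev i (D B) / (4 * (1 - σ * ev i B) ^ 2) := by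
  have h1 := congrArg (fun f => ev i (D f)) h.norm₂
  have h0 := h.ev_ne₂ i
  have h2 : D (2 : R) = 0 := by simpa using D.map_natCast 2
  simp only [Derivation.leibniz, map_sub, Derivation.map_one_eq_zero, Derivation.map_smul,
    smul_eq_mul, map_add, map_mul, map_one, map_smul, map_ofNat, h2, derivation_qf,
    qf_comm σ (dvec D₂ a) (dvec D (dvec D₂ a)), h.ev_norm₂, map_zero] at h1
  field_simp at h1 ⊢
  linear_combination h1 / 2

theorem deriv_orth (h : IsQuadricFrame ev D₁ D₂ α β σ a A B) (D : Derivation ℝ R R) :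
    qf σ (dvec D (dvec D₂ a)) (dvec D₁ a) = -qf σ (dvec D (dvec D₁ a)) (dvec D₂ a) := by
  have := congrArg D h.orth
  rw [derivation_qf, map_zero, qf_comm σ (dvec D₁ a)] at this
  linear_combination this

/-- As in the Koszul formula: differentiate the orthogonality of the frame along `D₁` and exchange
the order of derivatives by the bracket relation. Only derivatives of the squared lengths and the
bracket coefficients remain. -/
theorem conn₁ (h : IsQuadricFrame ev D₁ D₂ α β σ a A B) (i : ι) :
    ev i (qf σ (dvec D₁ (dvec D₁ a)) (dvec D₂ a)) =
      -(σ * ev i (D₂ A) / (4 * (1 - σ * ev i A) ^ 2)) - ev i α / (2 * (1 - σ * ev i A)) := by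
  have h1 := h.deriv_orth D₁
  rw [dvec_bracket h.bracket a, qf_add_left, qf_add_left, qf_smul_left, qf_smul_left,
    qf_comm σ (dvec D₂ a), h.orth] at h1
  have h2 := congrArg (ev i) h1
  simp only [map_add, map_mul, map_zero, map_neg, h.ev_norm₁, h.ev_deriv_norm₁] at h2
  linear_combination h2

theorem conn₂ (h : IsQuadricFrame ev D₁ D₂ α β σ a A B) (i : ι) :
    ev i (qf σ (dvec D₂ (dvec D₁ a)) (dvec D₂ a)) =
      σ * ev i (D₁ B) / (4 * (1 - σ * ev i B) ^ 2) - ev i β / (2 * (1 - σ * ev i B)) := by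
  have h1 := congrArg (fun u => ev i (qf σ u (dvec D₂ a))) (dvec_bracket h.bracket a)
  simp only [qf_add_left, qf_smul_left, h.orth, map_add, map_mul, map_zero, h.ev_norm₂,
    h.ev_deriv_norm₂] at h1
  linear_combination -h1

theorem orth_self (h : IsQuadricFrame ev D₁ D₂ α β σ a A B) (D : Derivation ℝ R R) :
    qf σ a (dvec D a) = 0 := by
  refine h.ext_ev _ _ fun i => ?_
  have := congrArg (fun f => ev i (D f)) h.quadric
  simp only [derivation_qf, Derivation.map_algebraMap, map_add, qf_comm σ (dvec D a) a,
    map_zero] at this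
  rw [map_zero]
  linarith

theorem deriv_self (h : IsQuadricFrame ev D₁ D₂ α β σ a A B) (D D' : Derivation ℝ R R) :
    qf σ (dvec D (dvec D' a)) a = -qf σ (dvec D' a) (dvec D a) := by
  have := congrArg D (h.orth_self D')
  rw [derivation_qf, map_zero, qf_comm σ (dvec D a), qf_comm σ a] at this
  linear_combination this

/-- At each point the position vector and the two frame vectors form an orthogonal basis of `ℝ³`,
with squares `σ`, `1 / (2 (1 - σ A))` and `1 / (2 (1 - σ B))`. -/
theorem ev_parseval (h : IsQuadricFrame ev D₁ D₂ α β σ a A B) (i : ι) (u w : Fin 3 → R) :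
    ev i (qf σ u w) = ev i (qf σ u a) * ev i (qf σ w a) / σ +
      ev i (qf σ u (dvec D₁ a)) * ev i (qf σ w (dvec D₁ a)) * (2 * (1 - σ * ev i A)) +
      ev i (qf σ u (dvec D₂ a)) * ev i (qf σ w (dvec D₂ a)) * (2 * (1 - σ * ev i B)) := by
  have hA := h.ev_norm₁ i
  have hB := h.ev_norm₂ i
  have hA0 := h.ev_ne₁ i
  have hB0 := h.ev_ne₂ i
  have hq := congrArg (ev i) h.quadric
  have h1 := congrArg (ev i) (h.orth_self D₁)
  have h2 := congrArg (ev i) (h.orth_self D₂)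
  have h3 := congrArg (ev i) h.orth
  rw [map_zero] at h1 h2 h3
  rw [AlgHom.commutes, Algebra.algebraMap_self, RingHom.id_apply] at hq
  rw [map_qf] at hA hB hq h1 h2 h3
  have := qf_parseval h1 h2 h3 (by rw [hq]; exact h.sigma_ne)
    (by rw [hA]; positivity) (by rw [hB]; positivity) (ev i ∘ u) (ev i ∘ w)
  simp only [map_qf]
  rw [this, hA, hB, hq]
  field_simp

/-- The normalized connection form of the frame in the direction `D`. -/
def conn (σ : ℝ) (a : Fin 3 → R) (A B : R) (D₁ D₂ D : Derivation ℝ R R) : R :=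
  (1 - σ • A) * (1 - σ • B) * qf σ (dvec D (dvec D₁ a)) (dvec D₂ a)

theorem ev_conn₁ (h : IsQuadricFrame ev D₁ D₂ α β σ a A B) (i : ι) :
    ev i (conn σ a A B D₁ D₂ D₁) =
      -((1 - σ * ev i B) * (σ * ev i (D₂ A) / (2 * (1 - σ * ev i A)) + ev i α) / 2) := by
  have hA0 := h.ev_ne₁ i
  simp only [conn, map_mul, h.conn₁, map_sub, map_one, map_smul, smul_eq_mul]
  field_simp
  ring

theorem ev_conn₂ (h : IsQuadricFrame ev D₁ D₂ α β σ a A B) (i : ι) :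
    ev i (conn σ a A B D₁ D₂ D₂) =
      (1 - σ * ev i A) * (σ * ev i (D₁ B) / (2 * (1 - σ * ev i B)) - ev i β) / 2 := by
  have hB0 := h.ev_ne₂ i
  simp only [conn, map_mul, h.conn₂, map_sub, map_one, map_smul, smul_eq_mul]
  field_simp
  ring

/-- The Gauss equation of the quadric in the frame. -/
theorem ev_gauss (h : IsQuadricFrame ev D₁ D₂ α β σ a A B) (i : ι) :
    ev i (D₁ (conn σ a A B D₁ D₂ D₂) - D₂ (conn σ a A B D₁ D₂ D₁) -
      α * conn σ a A B D₁ D₂ D₁ - β * conn σ a A B D₁ D₂ D₂) =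
    ev i (conn σ a A B D₁ D₂ D₁) / 2 *
      (σ * ev i (D₂ A) / (1 - σ * ev i A) + σ * ev i (D₂ B) / (1 - σ * ev i B)) -
    ev i (conn σ a A B D₁ D₂ D₂) / 2 *
      (σ * ev i (D₁ A) / (1 - σ * ev i A) + σ * ev i (D₁ B) / (1 - σ * ev i B)) - 1 / (4 * σ) := by
  have hA0 := h.ev_ne₁ i
  have hB0 := h.ev_ne₂ i
  have hσ := h.sigma_ne
  -- Flat derivatives commute up to the bracket, so third derivatives drop out. Once the remaining
  -- products are expanded in the frame, the components along `a` supply the curvature term `1 / (4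
  -- * σ)`.
  have key : D₁ (qf σ (dvec D₂ (dvec D₁ a)) (dvec D₂ a)) -
      D₂ (qf σ (dvec D₁ (dvec D₁ a)) (dvec D₂ a)) =
      α * qf σ (dvec D₁ (dvec D₁ a)) (dvec D₂ a) + β * qf σ (dvec D₂ (dvec D₁ a)) (dvec D₂ a) +
      qf σ (dvec D₂ (dvec D₁ a)) (dvec D₁ (dvec D₂ a)) -
      qf σ (dvec D₁ (dvec D₁ a)) (dvec D₂ (dvec D₂ a)) := by
    rw [derivation_qf, derivation_qf, dvec_bracket h.bracket (dvec D₁ a), qf_add_left, qf_add_left,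
      qf_smul_left, qf_smul_left]
    ring
  have key' := congrArg (ev i) key
  simp only [map_add, map_sub, map_mul, h.ev_parseval i (dvec D₂ (dvec D₁ a)) (dvec D₁ (dvec D₂ a)),
    h.ev_parseval i (dvec D₁ (dvec D₁ a)) (dvec D₂ (dvec D₂ a)), h.deriv_self, h.deriv_orth, h.orth, map_neg, map_zero,
    qf_comm σ (dvec D₂ a) (dvec D₁ a), h.ev_norm₁, h.ev_norm₂, h.ev_deriv_norm₁,
    h.ev_deriv_norm₂] at key'
  simp only [conn, map_sub, map_mul, Derivation.leibniz, smul_eq_mul, map_add, map_one, map_smul,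
    Derivation.map_smul, Derivation.map_one_eq_zero, map_zero]
  generalize ev i (D₁ (qf σ (dvec D₂ (dvec D₁ a)) (dvec D₂ a))) = d12 at key' ⊢
  generalize ev i (D₂ (qf σ (dvec D₁ (dvec D₁ a)) (dvec D₂ a))) = d21 at key' ⊢
  generalize ev i (qf σ (dvec D₁ (dvec D₁ a)) (dvec D₂ a)) = r1 at key' ⊢
  generalize ev i (qf σ (dvec D₂ (dvec D₁ a)) (dvec D₂ a)) = r2 at key' ⊢
  have : d12 = d21 + (d12 - d21) := by ring
  rw [this, key']
  field_simp
  ring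

end IsQuadricFrame

end Frame

/-! ### The immersion into the product: mean curvature, Hopf differential and normal connection -/

section ProductFrame

variable {ι R : Type*} [CommRing R] [Algebra ℝ R]

/-- The coefficient of the second fundamental form along the first normal of the frame. -/
def sffOne (a b : Fin 3 → R) (A : R) (D₁ D D' : Derivation ℝ R R) : R :=
  (1 - A) * qf 1 (dvec D (dvec D' a)) (dvec D₁ a) -
    (1 + A) * qf (-1) (dvec D (dvec D' b)) (dvec D₁ b)

/-- The first coordinate of the mean curvature vector in the normal frame. -/
def meanOne (a b : Fin 3 → R) (A B : R) (D₁ D₂ : Derivation ℝ R R) : R :=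
  (1 / 2 : ℝ) • ((1 - A ^ 2) * sffOne a b A D₁ D₁ D₁ + (1 - B ^ 2) * sffOne a b A D₁ D₂ D₂)

/-- The second coordinate, with the sign reversed, of the mean curvature vector in the normal
frame. -/
def meanTwo (a b : Fin 3 → R) (A B : R) (D₁ D₂ : Derivation ℝ R R) : R :=
  (-1 / 2 : ℝ) • ((1 - A ^ 2) * sffOne a b B D₂ D₁ D₁ + (1 - B ^ 2) * sffOne a b B D₂ D₂ D₂)

/-- The mean curvature vector, in the first factor. -/
def meanVecFst (a : Fin 3 → R) (A B x y : R) (D₁ D₂ : Derivation ℝ R R) : Fin 3 → R :=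
  (x * (1 - A)) • dvec D₁ a - (y * (1 - B)) • dvec D₂ a

/-- The mean curvature vector, in the second factor. -/
def meanVecSnd (b : Fin 3 → R) (A B x y : R) (D₁ D₂ : Derivation ℝ R R) : Fin 3 → R :=
  (y * (1 + B)) • dvec D₂ b - (x * (1 + A)) • dvec D₁ b

/-- An immersion `(a, b)` into `𝕊² × ℍ²` with the frame `D₁, D₂` that diagonalizes the metrics
of the two factors, and with parallel mean curvature vector. -/
structure IsParallelFrame (ev : ι → R →ₐ[ℝ] ℝ) (D₁ D₂ : Derivation ℝ R R) (α β : R)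
    (a b : Fin 3 → R) (A B x y : R) : Prop where
  fst : IsQuadricFrame ev D₁ D₂ α β 1 a A B
  snd : IsQuadricFrame ev D₁ D₂ α β (-1) b A B
  x_eq : x = meanOne a b A B D₁ D₂
  y_eq : y = meanTwo a b A B D₁ D₂
  parallel₁ : ∀ D, D = D₁ ∨ D = D₂ →
    (1 - A) * qf 1 (dvec D (meanVecFst a A B x y D₁ D₂)) (dvec D₁ a) -
      (1 + A) * qf (-1) (dvec D (meanVecSnd b A B x y D₁ D₂)) (dvec D₁ b) = 0
  parallel₂ : ∀ D, D = D₁ ∨ D = D₂ →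
    (1 - B) * qf 1 (dvec D (meanVecFst a A B x y D₁ D₂)) (dvec D₂ a) -
      (1 + B) * qf (-1) (dvec D (meanVecSnd b A B x y D₁ D₂)) (dvec D₂ b) = 0

/-- The Hopf differential vanishes on the frame. -/
structure HopfFrame (D₁ D₂ : Derivation ℝ R R) (a b : Fin 3 → R) (A B x y : R) : Prop where
  re : 4 * ((1 - A ^ 2) * (x * sffOne a b A D₁ D₁ D₁ - y * sffOne a b B D₂ D₁ D₁) -
      (1 - B ^ 2) * (x * sffOne a b A D₁ D₂ D₂ - y * sffOne a b B D₂ D₂ D₂)) + A - B = 0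
  im : x * (sffOne a b A D₁ D₁ D₂ + sffOne a b A D₁ D₂ D₁) -
      y * (sffOne a b B D₂ D₁ D₂ + sffOne a b B D₂ D₂ D₁) = 0

namespace IsParallelFrame

variable {ev : ι → R →ₐ[ℝ] ℝ} {D₁ D₂ : Derivation ℝ R R} {α β : R} {a b : Fin 3 → R}
  {A B x y : R}

theorem one_sub_ne (h : IsParallelFrame ev D₁ D₂ α β a b A B x y) (i : ι) :
    1 - ev i A ≠ 0 ∧ 1 + ev i A ≠ 0 ∧ 1 - ev i B ≠ 0 ∧ 1 + ev i B ≠ 0 :=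
  ⟨by simpa using h.fst.ev_ne₁ i, by simpa using h.snd.ev_ne₁ i, by simpa using h.fst.ev_ne₂ i,
    by simpa using h.snd.ev_ne₂ i⟩

/-- Since `F` is parallel, pairing the derivative of `v₁` with `F v₁ - A v₁` gives only the
derivative of the eigenvalue `A`. Concretely, it comes from differentiating the two normalizations
of `v₁`. -/
theorem ev_sffOne_left (h : IsParallelFrame ev D₁ D₂ α β a b A B x y) (D : Derivation ℝ R R)
    (i : ι) : ev i (sffOne a b A D₁ D D₁) = ev i (D A) / (2 * (1 - ev i A) * (1 + ev i A)) := by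
  obtain ⟨h1, h2, h3, h4⟩ := h.one_sub_ne i
  simp only [sffOne, map_sub, map_mul, map_add, map_one, h.fst.ev_deriv_norm₁,
    h.snd.ev_deriv_norm₁, one_mul, neg_mul, sub_neg_eq_add]
  field_simp
  ring

theorem ev_sffTwo_right (h : IsParallelFrame ev D₁ D₂ α β a b A B x y) (D : Derivation ℝ R R)
    (i : ι) : ev i (sffOne a b B D₂ D D₂) = ev i (D B) / (2 * (1 - ev i B) * (1 + ev i B)) := by
  obtain ⟨h1, h2, h3, h4⟩ := h.one_sub_ne i
  simp only [sffOne, map_sub, map_mul, map_add, map_one, h.fst.ev_deriv_norm₂,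
    h.snd.ev_deriv_norm₂, one_mul, neg_mul, sub_neg_eq_add]
  field_simp
  ring

/-- The bracket of the two fields is tangent, and tangent vectors are orthogonal to the normal
frame. -/
theorem sffOne_symm (h : IsParallelFrame ev D₁ D₂ α β a b A B x y) :
    sffOne a b A D₁ D₁ D₂ = sffOne a b A D₁ D₂ D₁ := by
  refine h.fst.ext_ev _ _ fun i => ?_
  obtain ⟨h1, h2, h3, h4⟩ := h.one_sub_ne i
  simp only [sffOne, dvec_bracket h.fst.bracket, qf_add_left,
    qf_smul_left, map_sub, map_mul, map_add, map_one, h.fst.ev_norm₁, h.snd.ev_norm₁,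
    qf_comm _ (dvec D₂ _) (dvec D₁ _), h.fst.orth, h.snd.orth, map_zero, one_mul, neg_mul,
    sub_neg_eq_add]
  field_simp
  ring

theorem sffTwo_symm (h : IsParallelFrame ev D₁ D₂ α β a b A B x y) :
    sffOne a b B D₂ D₂ D₁ = sffOne a b B D₂ D₁ D₂ := by
  refine h.fst.ext_ev _ _ fun i => ?_
  obtain ⟨h1, h2, h3, h4⟩ := h.one_sub_ne i
  simp only [sffOne, dvec_bracket h.fst.bracket, qf_add_left,
    qf_smul_left, map_sub, map_mul, map_add, map_one, h.fst.ev_norm₂, h.snd.ev_norm₂,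
    h.fst.orth, h.snd.orth, map_zero, one_mul, neg_mul,
    sub_neg_eq_add]
  field_simp
  ring

/-- Orthogonality of the frame within each factor turns this coefficient into the connection
coefficients along `D₂`. -/
theorem ev_sffOne_right (h : IsParallelFrame ev D₁ D₂ α β a b A B x y) (i : ι) :
    ev i (sffOne a b A D₁ D₂ D₂) =
      -((1 - ev i A) * (ev i (D₁ B) / (4 * (1 - ev i B) ^ 2) - ev i β / (2 * (1 - ev i B))) -
        (1 + ev i A) *
          (-(ev i (D₁ B)) / (4 * (1 + ev i B) ^ 2) - ev i β / (2 * (1 + ev i B)))) := by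
  simp only [sffOne, map_sub, map_mul, map_add, map_one, h.fst.deriv_orth, h.snd.deriv_orth,
    h.fst.conn₂, h.snd.conn₂, map_neg, one_mul, neg_mul, sub_neg_eq_add]
  ring

theorem ev_sffTwo_left (h : IsParallelFrame ev D₁ D₂ α β a b A B x y) (i : ι) :
    ev i (sffOne a b B D₂ D₁ D₁) =
      -((1 - ev i B) * (ev i (D₂ A) / (4 * (1 - ev i A) ^ 2) + ev i α / (2 * (1 - ev i A))) -
        (1 + ev i B) *
          (-(ev i (D₂ A)) / (4 * (1 + ev i A) ^ 2) + ev i α / (2 * (1 + ev i A)))) := by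
  simp only [sffOne, map_sub, map_mul, map_add, map_one,
    h.fst.conn₁, h.snd.conn₁, one_mul, neg_mul, sub_neg_eq_add]
  ring

theorem ev_x (h : IsParallelFrame ev D₁ D₂ α β a b A B x y) (i : ι) :
    ev i x = 1 / 2 * ((1 - ev i A ^ 2) * ev i (sffOne a b A D₁ D₁ D₁) +
      (1 - ev i B ^ 2) * ev i (sffOne a b A D₁ D₂ D₂)) := by
  conv_lhs => rw [h.x_eq]
  simp only [meanOne, map_smul, smul_eq_mul, map_add, map_mul, map_sub, map_one, map_pow]

theorem ev_y (h : IsParallelFrame ev D₁ D₂ α β a b A B x y) (i : ι) :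
    ev i y = -1 / 2 * ((1 - ev i A ^ 2) * ev i (sffOne a b B D₂ D₁ D₁) +
      (1 - ev i B ^ 2) * ev i (sffOne a b B D₂ D₂ D₂)) := by
  conv_lhs => rw [h.y_eq]
  simp only [meanTwo, map_smul, smul_eq_mul, map_add, map_mul, map_sub, map_one, map_pow]

/-- A surface on which the product structure is isotropic is minimal. -/
theorem eq_zero_of_eq (h : IsParallelFrame ev D₁ D₂ α β a b A B x y) (hAB : A = B) :
    x = 0 ∧ y = 0 := by
  subst hAB
  constructor <;> refine h.fst.ext_ev _ _ fun i => ?_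
  -- With equal eigenvalues the bracket coefficients drop out, and the two terms of the trace are
  -- opposite multiples of the derivative of `A`.
  · obtain ⟨h1, h2, h3, h4⟩ := h.one_sub_ne i
    rw [h.ev_x, h.ev_sffOne_left, h.ev_sffOne_right, map_zero]
    field_simp
    ring
  · obtain ⟨h1, h2, h3, h4⟩ := h.one_sub_ne i
    rw [h.ev_y, h.ev_sffTwo_left, h.ev_sffTwo_right, map_zero]
    field_simp
    ring

/-- The connection form of the normal frame. -/
def normalConn (a b : Fin 3 → R) (A B : R) (D₁ D₂ D : Derivation ℝ R R) : R :=
  IsQuadricFrame.conn 1 a A B D₁ D₂ D + IsQuadricFrame.conn (-1) b A B D₁ D₂ D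

/-- With `H = x ν₁ - y ν₂` and `τ` the normal connection form, `∇^⊥ ν₁ = τ ν₂` and `∇^⊥ ν₂ = -τ ν₁`.
The component of `∇^⊥ H = 0` along `ν₁` is this equation; the one along `ν₂` gives `deriv_y`. -/
theorem deriv_x (h : IsParallelFrame ev D₁ D₂ α β a b A B x y) {D : Derivation ℝ R R}
    (hD : D = D₁ ∨ D = D₂) : D x = -(y * normalConn a b A B D₁ D₂ D) := by
  refine h.fst.ext_ev _ _ fun i => ?_
  obtain ⟨h1, h2, h3, h4⟩ := h.one_sub_ne i
  have key := congrArg (ev i) (h.parallel₁ D hD)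
  simp only [meanVecFst, meanVecSnd, dvec_sub, dvec_smul, qf_sub_left, qf_add_left, qf_smul_left,
    qf_comm _ (dvec D₂ _) (dvec D₁ _), h.fst.orth, h.snd.orth, h.fst.deriv_orth, h.snd.deriv_orth,
    Derivation.leibniz, map_sub, map_add, Derivation.map_one_eq_zero, smul_eq_mul, map_mul,
    map_one, map_zero, h.fst.ev_norm₁, h.snd.ev_norm₁, h.fst.ev_deriv_norm₁,
    h.snd.ev_deriv_norm₁, one_mul, neg_mul, sub_neg_eq_add, map_neg] at key
  simp only [normalConn, IsQuadricFrame.conn, map_mul, map_neg, map_add, map_sub, map_one, one_smul,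
    neg_smul, sub_neg_eq_add]
  field_simp at key
  linear_combination key / 8

theorem deriv_y (h : IsParallelFrame ev D₁ D₂ α β a b A B x y) {D : Derivation ℝ R R}
    (hD : D = D₁ ∨ D = D₂) : D y = x * normalConn a b A B D₁ D₂ D := by
  refine h.fst.ext_ev _ _ fun i => ?_
  obtain ⟨h1, h2, h3, h4⟩ := h.one_sub_ne i
  have key := congrArg (ev i) (h.parallel₂ D hD)
  simp only [meanVecFst, meanVecSnd, dvec_sub, dvec_smul, qf_sub_left, qf_add_left, qf_smul_left,
    h.fst.orth, h.snd.orth,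
    Derivation.leibniz, map_sub, map_add, Derivation.map_one_eq_zero, smul_eq_mul, map_mul,
    map_one, map_zero, h.fst.ev_norm₂, h.snd.ev_norm₂, h.fst.ev_deriv_norm₂,
    h.snd.ev_deriv_norm₂, one_mul, neg_mul, sub_neg_eq_add] at key
  simp only [normalConn, IsQuadricFrame.conn, map_mul, map_add, map_sub, map_one, one_smul,
    neg_smul, sub_neg_eq_add]
  field_simp at key
  linear_combination -key / 8

/-- The normal bundle is flat. -/
theorem normalConn_flat (h : IsParallelFrame ev D₁ D₂ α β a b A B x y) {i : ι}
    (hi : ev i x ≠ 0 ∨ ev i y ≠ 0) :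
    ev i (D₁ (normalConn a b A B D₁ D₂ D₂) - D₂ (normalConn a b A B D₁ D₂ D₁) -
      α * normalConn a b A B D₁ D₂ D₁ - β * normalConn a b A B D₁ D₂ D₂) = 0 := by
  set τ₁ := normalConn a b A B D₁ D₂ D₁ with hτ₁
  set τ₂ := normalConn a b A B D₁ D₂ D₂ with hτ₂
  have x1 : D₁ x = -(y * τ₁) := h.deriv_x (Or.inl rfl)
  have x2 : D₂ x = -(y * τ₂) := h.deriv_x (Or.inr rfl)
  have y1 : D₁ y = x * τ₁ := h.deriv_y (Or.inl rfl)
  have y2 : D₂ y = x * τ₂ := h.deriv_y (Or.inr rfl)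
  have kx := h.fst.bracket x
  have ky := h.fst.bracket y
  rw [x1, x2, map_neg, map_neg, Derivation.leibniz, Derivation.leibniz, y1, y2] at kx
  rw [y1, y2, Derivation.leibniz, Derivation.leibniz, x1, x2] at ky
  simp only [smul_eq_mul] at kx ky
  -- The bracket relation on `x` and on `y` gives the normal curvature multiplied by `y` and by `x`;
  -- one of these factors is nonzero at the point.
  have kx' : y * (D₁ τ₂ - D₂ τ₁ - α * τ₁ - β * τ₂) = 0 := by linear_combination -kx
  have ky' : x * (D₁ τ₂ - D₂ τ₁ - α * τ₁ - β * τ₂) = 0 := by linear_combination ky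
  have kx'' := congrArg (ev i) kx'
  have ky'' := congrArg (ev i) ky'
  rw [map_mul, map_zero] at kx'' ky''
  rcases hi with hi | hi
  · exact (mul_eq_zero.mp ky'').resolve_left hi
  · exact (mul_eq_zero.mp kx'').resolve_left hi

/-- Where `H` vanishes, the real part of the Hopf equation reduces to `A = B`. -/
theorem ev_ne_zero_of_hopf (hH : HopfFrame D₁ D₂ a b A B x y) {i : ι}
    (hi : ev i A ≠ ev i B) : ev i x ≠ 0 ∨ ev i y ≠ 0 := by
  by_contra! hc
  have := congrArg (ev i) hH.re
  simp only [map_add, map_sub, map_mul, hc.1, hc.2, zero_mul, sub_zero, mul_zero, map_zero,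
    zero_add] at this
  exact hi (by linarith)

/-- The frame diagonalizes the second fundamental form. -/
theorem deriv_eq_zero (h : IsParallelFrame ev D₁ D₂ α β a b A B x y)
    (hH : HopfFrame D₁ D₂ a b A B x y) (hAB : ∀ i, ev i A ≠ ev i B) : D₂ A = 0 ∧ D₁ B = 0 := by
  suffices H : ∀ i, ev i (D₂ A) = 0 ∧ ev i (D₁ B) = 0 from
    ⟨h.fst.ext_ev _ _ fun i => by rw [(H i).1, map_zero],
      h.fst.ext_ev _ _ fun i => by rw [(H i).2, map_zero]⟩
  intro i
  obtain ⟨h1, h2, h3, h4⟩ := h.one_sub_ne i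
  have flat := h.normalConn_flat (ev_ne_zero_of_hopf hH (hAB i))
  -- The Ricci equation is the sum of the Gauss equations of the two factors, whose curvature terms
  -- `1 / (4 * σ)` cancel for `σ = 1` and `σ = -1`.
  have split : D₁ (normalConn a b A B D₁ D₂ D₂) - D₂ (normalConn a b A B D₁ D₂ D₁) -
      α * normalConn a b A B D₁ D₂ D₁ - β * normalConn a b A B D₁ D₂ D₂ =
      (D₁ (IsQuadricFrame.conn 1 a A B D₁ D₂ D₂) - D₂ (IsQuadricFrame.conn 1 a A B D₁ D₂ D₁) -
      α * IsQuadricFrame.conn 1 a A B D₁ D₂ D₁ - β * IsQuadricFrame.conn 1 a A B D₁ D₂ D₂) +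
      (D₁ (IsQuadricFrame.conn (-1) b A B D₁ D₂ D₂) -
      D₂ (IsQuadricFrame.conn (-1) b A B D₁ D₂ D₁) -
      α * IsQuadricFrame.conn (-1) b A B D₁ D₂ D₁ -
      β * IsQuadricFrame.conn (-1) b A B D₁ D₂ D₂) := by
    simp only [normalConn, map_add]; ring
  rw [split, map_add, h.fst.ev_gauss, h.snd.ev_gauss, h.fst.ev_conn₁, h.fst.ev_conn₂,
    h.snd.ev_conn₁, h.snd.ev_conn₂] at flat
  have re := congrArg (ev i) hH.re
  have im := congrArg (ev i) hH.im
  rw [h.sffOne_symm, h.sffTwo_symm] at im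
  simp only [map_add, map_sub, map_mul, map_pow, map_one, map_zero, map_ofNat, h.ev_sffOne_left,
    h.ev_sffTwo_right] at re im
  have hW1 := h.ev_sffTwo_left i
  have hW2 := h.ev_sffOne_right i
  generalize ev i (sffOne a b B D₂ D₁ D₁) = s at re hW1
  generalize ev i (sffOne a b A D₁ D₂ D₂) = t at re hW2
  have hAB := hAB i
  generalize ev i A = A' at *
  generalize ev i B = B' at *
  generalize ev i (D₂ A) = p at *
  generalize ev i (D₁ B) = q at *
  generalize ev i x = x at *
  generalize ev i y = y at *
  generalize ev i (D₁ A) = u at *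
  generalize ev i (D₂ B) = v at *
  generalize ev i α = α at *
  generalize ev i β = β at *
  -- Along `ν₁` the form `h` has off-diagonal coefficient `P` and diagonal coefficients `U, t`;
  -- along `ν₂` it has off-diagonal coefficient `Q` and diagonal coefficients `s, Z`.
  obtain ⟨P, hP⟩ : ∃ P, P = p / (2 * (1 - A') * (1 + A')) := ⟨_, rfl⟩
  obtain ⟨Q, hQ⟩ : ∃ Q, Q = q / (2 * (1 - B') * (1 + B')) := ⟨_, rfl⟩
  obtain ⟨U, hU⟩ : ∃ U, U = u / (2 * (1 - A') * (1 + A')) := ⟨_, rfl⟩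
  obtain ⟨Z, hZ⟩ : ∃ Z, Z = v / (2 * (1 - B') * (1 + B')) := ⟨_, rfl⟩
  have hp : p = P * (2 * (1 - A') * (1 + A')) := by rw [hP]; field_simp
  have hq : q = Q * (2 * (1 - B') * (1 + B')) := by rw [hQ]; field_simp
  have hu : u = U * (2 * (1 - A') * (1 + A')) := by rw [hU]; field_simp
  have hv : v = Z * (2 * (1 - B') * (1 + B')) := by rw [hZ]; field_simp
  simp only [one_mul, neg_mul, sub_neg_eq_add] at flat
  rw [← hU, ← hZ] at re
  rw [← hP, ← hQ] at im
  clear hP hQ hU hZ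
  subst hp hq hu hv
  -- Flatness as the commutation of the two trace-free shape operators.
  have ricci : P * ((1 - A' ^ 2) * s - (1 - B' ^ 2) * Z) -
      Q * ((1 - A' ^ 2) * U - (1 - B' ^ 2) * t) = 0 := by
    have hs : (1 - A' ^ 2) * s = -((1 - B') * (1 + A') * (P * (1 + A') + α) -
        (1 + B') * (1 - A') * (-(P * (1 - A')) + α)) / 2 := by
      rw [hW1]; field_simp; ring
    have ht : (1 - B' ^ 2) * t = -((1 - A') * (1 + B') * (Q * (1 + B') - β) -
        (1 + A') * (1 - B') * (-(Q * (1 - B')) - β)) / 2 := by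
      rw [hW2]; field_simp; ring
    field_simp at flat
    linear_combination P * hs + Q * ht + flat / 8
  -- The vector `(P, Q)` is parallel to the vector of diagonal differences by `ricci` and orthogonal
  -- to `(x, -y)` by `im`, whereas by `re` the diagonal differences pair with `(x, -y)` to `-(A' -
  -- B') / 4 ≠ 0`. Hence `(P, Q) = 0`.
  have hPL : P * (A' - B') = 0 := by
    linear_combination P * re + 4 * y * ricci - 2 * ((1 - A' ^ 2) * U - (1 - B' ^ 2) * t) * im
  have hQL : Q * (A' - B') = 0 := by
    linear_combination Q * re + 4 * x * ricci - 2 * ((1 - A' ^ 2) * s - (1 - B' ^ 2) * Z) * im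
  have hP0 := (mul_eq_zero.mp hPL).resolve_right (sub_ne_zero.mpr hAB)
  have hQ0 := (mul_eq_zero.mp hQL).resolve_right (sub_ne_zero.mpr hAB)
  simp [hP0, hQ0]

end IsParallelFrame

end ProductFrame

/-! ### The overdetermined system and its inconsistency -/

/-- The algebraic relations that are left when the integrability conditions of a parallel frame
with vanishing Hopf differential have been differentiated once. -/
theorem ratio_of_relations {x y M N Δ : ℝ} (hΔ : Δ = M ^ 2 - N ^ 2) (hΔ0 : Δ ≠ 0)
    (h1 : y * M - x * N = Δ) (h2 : Δ * (5 * N - 3 * x) = 2 * M * N * (M - y))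
    (h3 : Δ * (5 * M - 3 * y) = 2 * M * N * (x - N)) :
    (8 * Δ) ^ 2 * 49 = 144 * (x ^ 2 + y ^ 2) ^ 2 ∧ (x + N ≠ 0 ∨ M + y ≠ 0) := by
  have hd : 0 < 9 * Δ ^ 2 + 4 * M ^ 2 * N ^ 2 := by positivity
  -- `h2` and `h3` are linear in `x, y` with determinant `9 * Δ ^ 2 + 4 * M ^ 2 * N ^ 2`. Solving
  -- them and inserting the result into `h1` leaves an equation in `M, N` alone.
  have hx : (9 * Δ ^ 2 + 4 * M ^ 2 * N ^ 2) * x =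
      N * (15 * Δ ^ 2 + 4 * Δ * M ^ 2 + 4 * M ^ 2 * N ^ 2) := by
    linear_combination -3 * Δ * h2 - 2 * M * N * h3
  have hy : (9 * Δ ^ 2 + 4 * M ^ 2 * N ^ 2) * y =
      M * (15 * Δ ^ 2 - 4 * Δ * N ^ 2 + 4 * M ^ 2 * N ^ 2) := by
    linear_combination -3 * Δ * h3 + 2 * M * N * h2
  have hk : Δ * (6 * Δ ^ 2 - 8 * M ^ 2 * N ^ 2) = 0 := by
    linear_combination (9 * Δ ^ 2 + 4 * M ^ 2 * N ^ 2) * h1 - M * hy + N * hx +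
      (15 * Δ ^ 2 + 4 * M ^ 2 * N ^ 2) * hΔ
  have hk' : (3 * M ^ 2 - N ^ 2) * (M ^ 2 - 3 * N ^ 2) = 0 := by
    have := (mul_eq_zero.mp hk).resolve_left hΔ0
    rw [hΔ] at this
    linear_combination this / 2
  -- The two cases are exchanged by swapping `M, y` with `N, x` and changing the sign of `Δ`. In the
  -- first, `y = 2 * M` and `x ^ 2 = 16 / 3 * M ^ 2`, so `x ^ 2 + y ^ 2 = 28 / 3 * M ^ 2` and `8 * Δ
  -- = -16 * M ^ 2`, whence the constants `49` and `144`.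
  rcases mul_eq_zero.mp hk' with h | h
  · have hM : M ≠ 0 := by
      rintro rfl
      have hN : N ^ 2 = 0 := by linear_combination -h
      exact hΔ0 (by rw [hΔ, hN]; ring)
    have hΔ' : Δ = -2 * M ^ 2 := by linear_combination hΔ + h
    have hN2 : N ^ 2 = 3 * M ^ 2 := by linear_combination -h
    have hMy : y = 2 * M := by
      have h7 : 4 * (-2 * M ^ 2) * N ^ 2 = 4 * (-2 * M ^ 2) * (3 * M ^ 2) := by rw [hN2]
      have h8 : 4 * M ^ 2 * N ^ 2 = 4 * M ^ 2 * (3 * M ^ 2) := by rw [hN2]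
      rw [hΔ', h7, h8] at hy
      have : 48 * M ^ 4 * (y - 2 * M) = 0 := by linear_combination hy
      linarith [(mul_eq_zero.mp this).resolve_left (by positivity)]
    have hNx : N * x = 4 * M ^ 2 := by
      rw [hMy, hΔ'] at h1; linear_combination -h1
    have hx2 : x ^ 2 = 16 / 3 * M ^ 2 := by
      have : 3 * M ^ 2 * (x ^ 2 - 16 / 3 * M ^ 2) = 0 := by
        linear_combination (N * x + 4 * M ^ 2) * hNx - x ^ 2 * hN2
      have := (mul_eq_zero.mp this).resolve_left (by positivity)
      linarith
    refine ⟨?_, Or.inr ?_⟩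
    · rw [hΔ', hMy, hx2]; ring
    · rw [hMy]; intro h0; exact hM (by linarith)
  · have hN : N ≠ 0 := by
      rintro rfl
      have hM : M ^ 2 = 0 := by linear_combination h
      exact hΔ0 (by rw [hΔ, hM]; ring)
    have hM2 : M ^ 2 = 3 * N ^ 2 := by linear_combination h
    have hΔ' : Δ = 2 * N ^ 2 := by linear_combination hΔ + h
    have hNx : x = 2 * N := by
      have h7 : 4 * (2 * N ^ 2) * M ^ 2 = 4 * (2 * N ^ 2) * (3 * N ^ 2) := by rw [hM2]
      have h8 : 4 * M ^ 2 * N ^ 2 = 4 * (3 * N ^ 2) * N ^ 2 := by rw [hM2]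
      rw [hΔ', h7, h8] at hx
      have : 48 * N ^ 4 * (x - 2 * N) = 0 := by linear_combination hx
      linarith [(mul_eq_zero.mp this).resolve_left (by positivity)]
    have hMy : M * y = 4 * N ^ 2 := by
      rw [hNx, hΔ'] at h1; linear_combination h1
    have hy2 : y ^ 2 = 16 / 3 * N ^ 2 := by
      have : 3 * N ^ 2 * (y ^ 2 - 16 / 3 * N ^ 2) = 0 := by
        linear_combination (M * y + 4 * N ^ 2) * hMy - y ^ 2 * hM2
      have := (mul_eq_zero.mp this).resolve_left (by positivity)
      linarith
    refine ⟨?_, Or.inl ?_⟩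
    · rw [hΔ', hNx, hy2]; ring
    · rw [hNx]; intro h0; exact hN (by linarith)

section

variable {ι R : Type*} [CommRing R] [Algebra ℝ R] {ev : ι → R →ₐ[ℝ] ℝ}
  {D₁ D₂ : Derivation ℝ R R} {α β A B x y M N L : R}

/-- The structure equations of a parallel frame with vanishing Hopf differential, in terms of the
coefficients `x, y` of the mean curvature vector and `M, N` of the trace-free second fundamental
form. -/
structure IsHopfSystem (ev : ι → R →ₐ[ℝ] ℝ) (D₁ D₂ : Derivation ℝ R R)
    (α β A B x y M N L : R) : Prop where
  ext_ev : ∀ f g : R, (∀ i, ev i f = ev i g) → f = g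
  bracket : ∀ f, D₁ (D₂ f) - D₂ (D₁ f) = α * D₁ f + β * D₂ f
  L_eq : L = A - B
  L_eq' : L = 8 * (y * M - x * N)
  L_ne : ∀ i, ev i L ≠ 0
  A_one : D₁ A = 2 * (x + N)
  A_two : D₂ A = 0
  B_one : D₁ B = 0
  B_two : D₂ B = -2 * (M + y)
  N_eq : N = x + L * β
  M_eq : M = y - L * α
  x_one : D₁ x = α * y
  x_two : D₂ x = β * y
  y_one : D₁ y = -(α * x)
  y_two : D₂ y = -(β * x)
  gauss : D₂ α + α ^ 2 = D₁ β - β ^ 2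
  gauss' : -2 * L * (D₁ β - β ^ 2) = 2 * β * (x + N) + 2 * α * (M + y) + 1

namespace IsHopfSystem

theorem L_one (h : IsHopfSystem ev D₁ D₂ α β A B x y M N L) : D₁ L = 2 * (x + N) := by
  rw [h.L_eq, map_sub, h.A_one, h.B_one, sub_zero]

theorem L_two (h : IsHopfSystem ev D₁ D₂ α β A B x y M N L) : D₂ L = 2 * (M + y) := by
  rw [h.L_eq, map_sub, h.A_two, h.B_two]; ring

/-- Differentiating `N = x + L β` along `D₁` brings in `D₁ β`, which the Gauss equations determine.
In the same way `M_two` comes from `D₂ α`. -/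
theorem N_one (h : IsHopfSystem ev D₁ D₂ α β A B x y M N L) :
    2 * (L * D₁ N) = 2 * (M * (M - y) - 2 * N * (x - N)) - L := by
  have key := congrArg D₁ h.N_eq
  rw [map_add, Derivation.leibniz, h.x_one, h.L_one, smul_eq_mul, smul_eq_mul] at key
  linear_combination 2 * L * key - L * h.gauss' - 2 * M * h.M_eq -
    (2 * (x + N) + 2 * (L * β + N - x)) * h.N_eq

/-- Since `D₂ A = 0`, the bracket relation on `A` is an equation for `D₂ (D₁ A)`, hence for `D₂ N`.
In the same way `M_one` comes from `B`. -/
theorem N_two (h : IsHopfSystem ev D₁ D₂ α β A B x y M N L) :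
    L * D₂ N = 2 * N * (M - y) + M * (x - N) := by
  refine h.ext_ev _ _ fun i => ?_
  have key := congrArg (ev i) (h.bracket A)
  have h2 : ∀ D : Derivation ℝ R R, D (2 : R) = 0 := fun D => by simpa using D.map_natCast 2
  simp only [h.A_one, h.A_two, map_zero, Derivation.leibniz, h2, map_add, smul_eq_mul, mul_zero,
    add_zero, zero_sub, map_neg, map_mul, map_ofNat, h.x_two] at key
  have k1 := congrArg (ev i) h.N_eq
  have k2 := congrArg (ev i) h.M_eq
  simp only [map_add, map_sub, map_mul, map_ofNat] at k1 k2 ⊢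
  linear_combination -ev i L / 2 * key + ev i y * k1 - (ev i x + ev i N) * k2

theorem M_one (h : IsHopfSystem ev D₁ D₂ α β A B x y M N L) :
    L * D₁ M = -(2 * M * (x - N)) - N * (M - y) := by
  refine h.ext_ev _ _ fun i => ?_
  have key := congrArg (ev i) (h.bracket B)
  have h2 : ∀ D : Derivation ℝ R R, D (2 : R) = 0 := fun D => by simpa using D.map_natCast 2
  simp only [h.B_one, h.B_two, map_zero, Derivation.leibniz, h2, map_add, smul_eq_mul, mul_zero,
    add_zero, sub_zero, map_neg, map_mul, map_ofNat, h.y_one, neg_zero, zero_add] at key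
  have k1 := congrArg (ev i) h.N_eq
  have k2 := congrArg (ev i) h.M_eq
  simp only [map_add, map_sub, map_mul, map_ofNat, map_neg] at k1 k2 ⊢
  linear_combination -ev i L / 2 * key - (ev i M + ev i y) * k1 + ev i x * k2

theorem M_two (h : IsHopfSystem ev D₁ D₂ α β A B x y M N L) :
    2 * (L * D₂ M) = 2 * (2 * M * (M - y) - N * (x - N)) + L := by
  have key := congrArg D₂ h.M_eq
  rw [map_sub, Derivation.leibniz, h.y_two, h.L_two, smul_eq_mul, smul_eq_mul] at key
  linear_combination 2 * L * key - 2 * L ^ 2 * h.gauss + L * h.gauss' - 2 * N * h.N_eq +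
    (2 * L * α - 4 * M) * h.M_eq

/-- The integrability condition of the structure equations. -/
theorem quadratic (h : IsHopfSystem ev D₁ D₂ α β A B x y M N L) :
    M ^ 2 - N ^ 2 = y * M - x * N := by
  refine h.ext_ev _ _ fun i => ?_
  have h2 : ∀ D : Derivation ℝ R R, D (2 : R) = 0 := fun D => by simpa using D.map_natCast 2
  have n1 := congrArg (ev i) h.N_one
  have n2 := congrArg (ev i) h.N_two
  have m1 := congrArg (ev i) h.M_one
  have m2 := congrArg (ev i) h.M_two
  have bn := congrArg (ev i) (h.bracket N)
  have bm := congrArg (ev i) (h.bracket M)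
  have dn1 := congrArg (fun f => ev i (D₂ f)) h.N_one
  have dn2 := congrArg (fun f => ev i (D₁ f)) h.N_two
  have dm1 := congrArg (fun f => ev i (D₂ f)) h.M_one
  have dm2 := congrArg (fun f => ev i (D₁ f)) h.M_two
  have e1 := congrArg (ev i) h.N_eq
  have e2 := congrArg (ev i) h.M_eq
  have eL := congrArg (ev i) h.L_eq'
  have hL := h.L_ne i
  simp only [map_add, map_sub, map_mul, map_neg, Derivation.leibniz, smul_eq_mul, h2, mul_zero,
    add_zero, h.L_one, h.L_two, h.x_one, h.x_two, h.y_one, h.y_two, map_ofNat]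
    at n1 n2 m1 m2 bn bm dn1 dn2 dm1 dm2 e1 e2 eL
  simp only [map_sub, map_pow, map_mul]
  generalize ev i (D₁ (D₂ N)) = n12 at *
  generalize ev i (D₂ (D₁ N)) = n21 at *
  generalize ev i (D₁ (D₂ M)) = m12 at *
  generalize ev i (D₂ (D₁ M)) = m21 at *
  generalize ev i (D₁ N) = n1' at *
  generalize ev i (D₂ N) = n2' at *
  generalize ev i (D₁ M) = m1' at *
  generalize ev i (D₂ M) = m2' at *
  generalize ev i L = L at *
  generalize ev i x = x at *
  generalize ev i y = y at *
  generalize ev i M = M at *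
  generalize ev i N = N at *
  generalize ev i α = α at *
  generalize ev i β = β at *
  -- Every first derivative is eliminated in favour of `L, x, y, M, N`; the bracket relations on `N`
  -- and `M` then become algebraic.
  obtain rfl : α = (y - M) / L := by field_simp; linear_combination e2
  obtain rfl : β = (N - x) / L := by field_simp; linear_combination -e1
  obtain rfl : n1' = (2 * (M * (M - y) - 2 * N * (x - N)) - L) / (2 * L) := by
    field_simp; linear_combination n1
  obtain rfl : n2' = (2 * N * (M - y) + M * (x - N)) / L := by field_simp; linear_combination n2
  obtain rfl : m1' = (-(2 * M * (x - N)) - N * (M - y)) / L := by field_simp; linear_combination m1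
  obtain rfl : m2' = (2 * (2 * M * (M - y) - N * (x - N)) + L) / (2 * L) := by
    field_simp; linear_combination m2
  clear n1 n2 m1 m2 e1 e2
  have hy : y * (M ^ 2 - N ^ 2 - (y * M - x * N)) = 0 := by
    field_simp at bn dn1 dn2
    linear_combination -(bn + dn1 - dn2) / 32 - (M - y) / 8 * eL
  have hx : x * (M ^ 2 - N ^ 2 - (y * M - x * N)) = 0 := by
    field_simp at bm dm1 dm2
    linear_combination -(bm + dm1 - dm2) / 32 - (N - x) / 8 * eL
  -- The bracket relations give the condition multiplied by `y` and by `x`; these are recombined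
  -- through `L = 8 (y M - x N)`, and `L` does not vanish.
  have : L * (M ^ 2 - N ^ 2 - (y * M - x * N)) = 0 := by
    linear_combination (M ^ 2 - N ^ 2 - (y * M - x * N)) * eL + 8 * M * hy - 8 * N * hx
  linarith [(mul_eq_zero.mp this).resolve_left hL]

/-- Since `H` is parallel, `x ^ 2 + y ^ 2` is constant. The relation `hc` makes `L ^ 2` constant,
against the nonvanishing of `D₁ L = 2 (x + N)` or `D₂ L = 2 (M + y)`. -/
theorem false (h : IsHopfSystem ev D₁ D₂ α β A B x y M N L) (i : ι) : False := by
  have h2 : ∀ D : Derivation ℝ R R, D (2 : R) = 0 := fun D => by simpa using D.map_natCast 2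
  have h8 : ∀ D : Derivation ℝ R R, D (8 : R) = 0 := fun D => by simpa using D.map_natCast 8
  have h49 : ∀ D : Derivation ℝ R R, D (49 : R) = 0 := fun D => by simpa using D.map_natCast 49
  have h144 : ∀ D : Derivation ℝ R R, D (144 : R) = 0 := fun D => by
    simpa using D.map_natCast 144
  have hQ : L = 8 * (M ^ 2 - N ^ 2) := by rw [h.quadratic]; exact h.L_eq'
  have key : ∀ j, (ev j L ^ 2 * 49 = 144 * (ev j x ^ 2 + ev j y ^ 2) ^ 2) ∧
      (ev j x + ev j N ≠ 0 ∨ ev j M + ev j y ≠ 0) := by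
    intro j
    have q1 := congrArg (fun f => ev j (D₁ f)) hQ
    have q2 := congrArg (fun f => ev j (D₂ f)) hQ
    have n1 := congrArg (ev j) h.N_one
    have n2 := congrArg (ev j) h.N_two
    have m1 := congrArg (ev j) h.M_one
    have m2 := congrArg (ev j) h.M_two
    have q := congrArg (ev j) h.quadratic
    have hL := h.L_ne j
    have eL := congrArg (ev j) hQ
    simp only [map_add, map_sub, map_mul, map_neg, map_pow, Derivation.leibniz,
      Derivation.leibniz_pow, smul_eq_mul, nsmul_eq_mul, h8, mul_zero, add_zero, h.L_one, h.L_two,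
      map_ofNat, Nat.cast_ofNat, pow_one, Nat.add_one_sub_one] at q1 q2 n1 n2 m1 m2 q eL
    rw [eL] at hL ⊢
    -- The last two hypotheses are the derivatives of `L = 8 (M ^ 2 - N ^ 2)` along `D₁` and `D₂`,
    -- multiplied by `L` so that the formulas for the derivatives of `M, N` apply.
    refine ratio_of_relations rfl (by intro h0; exact hL (by rw [h0, mul_zero])) q.symm ?_ ?_
    · linear_combination -(ev j L * q1 + 16 * ev j M * m1 - 8 * ev j N * n1) / 16 +
        (2 * (ev j x + ev j N) - 8 * ev j N) / 16 * eL
    · linear_combination -(ev j L * q2 + 8 * ev j M * m2 - 16 * ev j N * n2) / 16 +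
        (2 * (ev j M + ev j y) - 8 * ev j M) / 16 * eL
  have hc : L ^ 2 * 49 = 144 * (x ^ 2 + y ^ 2) ^ 2 :=
    h.ext_ev _ _ fun j => by
      simpa only [map_mul, map_pow, map_add, map_ofNat] using (key j).1
  have c1 := congrArg (fun f => ev i (D₁ f)) hc
  have c2 := congrArg (fun f => ev i (D₂ f)) hc
  simp only [map_add, map_mul, map_neg, map_pow, Derivation.leibniz,
      Derivation.leibniz_pow, smul_eq_mul, nsmul_eq_mul, h49, h144, mul_zero, add_zero, h.L_one,
      h.L_two, h.x_one, h.x_two, h.y_one, h.y_two,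
      map_ofNat, Nat.cast_ofNat, pow_one, Nat.add_one_sub_one, zero_add] at c1 c2
  have hL := h.L_ne i
  rcases (key i).2 with hk | hk
  · have : ev i L * (ev i x + ev i N) = 0 := by linear_combination c1 / 196
    exact (mul_ne_zero hL hk) this
  · have : ev i L * (ev i M + ev i y) = 0 := by linear_combination c2 / 196
    exact (mul_ne_zero hL hk) this

end IsHopfSystem

end

open IsParallelFrame IsQuadricFrame in
-- Once `D₂ A = D₁ B = 0`, the normal connection form is `-α, -β` and the diagonal coefficients of
-- `h` are `D₁ A / 2`, `D₂ B / 2` and multiples of `A - B`. The definitions of `x, y`, the Hopf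
-- equation and the Gauss equations of the factors then form an `IsHopfSystem`.
theorem IsParallelFrame.false {ι R : Type*} [CommRing R] [Algebra ℝ R] {ev : ι → R →ₐ[ℝ] ℝ}
    {D₁ D₂ : Derivation ℝ R R} {α β : R} {a b : Fin 3 → R} {A B x y : R}
    (h : IsParallelFrame ev D₁ D₂ α β a b A B x y) (hH : HopfFrame D₁ D₂ a b A B x y)
    (hAB : ∀ i, ev i A ≠ ev i B) (i : ι) : False := by
  obtain ⟨hA2, hB1⟩ := h.deriv_eq_zero hH hAB
  have hτ₁ : normalConn a b A B D₁ D₂ D₁ = -α := by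
    refine h.fst.ext_ev _ _ fun j => ?_
    rw [normalConn, map_add, h.fst.ev_conn₁, h.snd.ev_conn₁, hA2, map_neg, map_zero]
    ring
  have hτ₂ : normalConn a b A B D₁ D₂ D₂ = -β := by
    refine h.fst.ext_ev _ _ fun j => ?_
    rw [normalConn, map_add, h.fst.ev_conn₂, h.snd.ev_conn₂, hB1, map_neg, map_zero]
    ring
  have hW1 : ∀ j, (1 - ev j A ^ 2) * ev j (sffOne a b B D₂ D₁ D₁) =
      -(ev j α * (ev j A - ev j B)) := by
    intro j
    obtain ⟨h1, h2, h3, h4⟩ := h.one_sub_ne j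
    rw [h.ev_sffTwo_left, hA2, map_zero]
    field_simp
    ring
  have hW2 : ∀ j, (1 - ev j B ^ 2) * ev j (sffOne a b A D₁ D₂ D₂) =
      -(ev j β * (ev j A - ev j B)) := by
    intro j
    obtain ⟨h1, h2, h3, h4⟩ := h.one_sub_ne j
    rw [h.ev_sffOne_right, hB1, map_zero]
    field_simp
    ring
  have hU1 : ∀ j, (1 - ev j A ^ 2) * ev j (sffOne a b A D₁ D₁ D₁) = ev j (D₁ A) / 2 := by
    intro j
    obtain ⟨h1, h2, h3, h4⟩ := h.one_sub_ne j
    rw [h.ev_sffOne_left]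
    field_simp
    ring
  have hU2 : ∀ j, (1 - ev j B ^ 2) * ev j (sffOne a b B D₂ D₂ D₂) = ev j (D₂ B) / 2 := by
    intro j
    obtain ⟨h1, h2, h3, h4⟩ := h.one_sub_ne j
    rw [h.ev_sffTwo_right]
    field_simp
    ring
  have hx : ∀ j, ev j x = 1 / 2 * (ev j (D₁ A) / 2 - ev j β * (ev j A - ev j B)) := by
    intro j
    rw [h.ev_x, hU1, hW2]; ring
  have hy : ∀ j, ev j y = -1 / 2 * (ev j (D₂ B) / 2 - ev j α * (ev j A - ev j B)) := by
    intro j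
    rw [h.ev_y, hU2, hW1]; ring
  -- The Gauss equations of the sphere (`g₁`) and of the hyperbolic plane (`g₂`). Half their sum is
  -- `gauss`; the curvature survives in the combination `gauss'`.
  have g₁ : ∀ j, (1 - ev j B) * (ev j (D₂ α) + ev j α ^ 2) -
      (1 - ev j A) * (ev j (D₁ β) - ev j β ^ 2) + ev j β * ev j (D₁ A) / 2 -
      ev j α * ev j (D₂ B) / 2 + 1 / 2 = 0 := by
    intro j
    obtain ⟨h1, h2, h3, h4⟩ := h.one_sub_ne j
    have c₁ : conn (1) a A B D₁ D₂ D₁ = (-1 / 2 : ℝ) • ((1 - B) * α) := by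
      refine h.fst.ext_ev _ _ fun k => ?_
      rw [h.fst.ev_conn₁, hA2]
      simp only [map_smul, map_mul, map_sub, map_one, map_zero, smul_eq_mul]
      ring
    have c₂ : conn (1) a A B D₁ D₂ D₂ = (-1 / 2 : ℝ) • ((1 - A) * β) := by
      refine h.fst.ext_ev _ _ fun k => ?_
      rw [h.fst.ev_conn₂, hB1]
      simp only [map_smul, map_mul, map_sub, map_one, map_zero, smul_eq_mul]
      ring
    have key := h.fst.ev_gauss j
    simp only [c₁, c₂, hA2, hB1, Derivation.map_smul, Derivation.leibniz, map_smul, map_sub, map_add,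
      Derivation.map_one_eq_zero, map_mul, smul_eq_mul, map_one, map_zero, one_mul] at key
    field_simp at key
    refine (mul_eq_zero.mp (?_ : 8 * ((1 - ev j A) * (1 - ev j B)) * _ = 0)).resolve_left
      (by positivity)
    linear_combination key
  have g₂ : ∀ j, (1 + ev j B) * (ev j (D₂ α) + ev j α ^ 2) -
      (1 + ev j A) * (ev j (D₁ β) - ev j β ^ 2) - ev j β * ev j (D₁ A) / 2 +
      ev j α * ev j (D₂ B) / 2 - 1 / 2 = 0 := by
    intro j
    obtain ⟨h1, h2, h3, h4⟩ := h.one_sub_ne j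
    have c₁ : conn (-1) b A B D₁ D₂ D₁ = (-1 / 2 : ℝ) • ((1 + B) * α) := by
      refine h.fst.ext_ev _ _ fun k => ?_
      rw [h.snd.ev_conn₁, hA2]
      simp only [map_smul, map_mul, map_add, map_one, map_zero, smul_eq_mul]
      ring
    have c₂ : conn (-1) b A B D₁ D₂ D₂ = (-1 / 2 : ℝ) • ((1 + A) * β) := by
      refine h.fst.ext_ev _ _ fun k => ?_
      rw [h.snd.ev_conn₂, hB1]
      simp only [map_smul, map_mul, map_add, map_one, map_zero, smul_eq_mul]
      ring
    have key := h.snd.ev_gauss j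
    simp only [c₁, c₂, hA2, hB1, Derivation.map_smul, Derivation.leibniz, map_smul, map_sub, map_add,
      Derivation.map_one_eq_zero, map_mul, smul_eq_mul, map_one, map_zero, one_mul, neg_mul,
      sub_neg_eq_add] at key
    field_simp at key
    refine (mul_eq_zero.mp (?_ : 8 * ((1 + ev j A) * (1 + ev j B)) * _ = 0)).resolve_left
      (by positivity)
    linear_combination key
  have sys : IsHopfSystem ev D₁ D₂ α β A B x y (y - (A - B) * α) (x + (A - B) * β) (A - B) :=
    { ext_ev := h.fst.ext_ev
      bracket := h.fst.bracket
      L_eq := rfl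
      L_eq' := by
        refine h.fst.ext_ev _ _ fun j => ?_
        have := congrArg (ev j) hH.re
        simp only [map_add, map_sub, map_mul, map_pow, map_one, map_zero, map_ofNat] at this ⊢
        linear_combination this - 4 * ev j x * hU1 j + 4 * ev j y * hW1 j + 4 * ev j x * hW2 j -
          4 * ev j y * hU2 j + 8 * ev j x * hx j - 8 * ev j y * hy j
      L_ne := fun j => by rw [map_sub]; exact sub_ne_zero.mpr (hAB j)
      A_one := by
        refine h.fst.ext_ev _ _ fun j => ?_
        simp only [map_add, map_sub, map_mul, map_ofNat]
        linear_combination -4 * hx j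
      A_two := hA2
      B_one := hB1
      B_two := by
        refine h.fst.ext_ev _ _ fun j => ?_
        simp only [map_add, map_sub, map_mul, map_ofNat, map_neg]
        linear_combination 4 * hy j
      N_eq := rfl
      M_eq := rfl
      x_one := by rw [h.deriv_x (Or.inl rfl), hτ₁]; ring
      x_two := by rw [h.deriv_x (Or.inr rfl), hτ₂]; ring
      y_one := by rw [h.deriv_y (Or.inl rfl), hτ₁]; ring
      y_two := by rw [h.deriv_y (Or.inr rfl), hτ₂]; ring
      gauss := by
        refine h.fst.ext_ev _ _ fun j => ?_
        simp only [map_add, map_sub, map_pow]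
        linear_combination (g₁ j + g₂ j) / 2
      gauss' := by
        refine h.fst.ext_ev _ _ fun j => ?_
        simp only [map_add, map_sub, map_mul, map_ofNat, map_neg, map_one, map_pow]
        linear_combination -(g₁ j - g₂ j) - ev j B * (g₁ j + g₂ j) - 4 * ev j β * hx j -
          4 * ev j α * hy j }
  exact sys.false i

/-! ### The ring of smooth functions on an open set of the coordinate plane -/

/-- The smooth functions on `U`. -/
def smoothRing (U : Set E2) : Subalgebra ℝ (U → ℝ) where
  carrier := {f | ∃ F : E2 → ℝ, ContDiffOn ℝ ∞ F U ∧ ∀ x : U, F x = f x}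
  mul_mem' := by
    rintro f g ⟨F, hF, hFf⟩ ⟨G, hG, hGg⟩
    exact ⟨F * G, hF.mul hG, fun x => by simp [hFf, hGg]⟩
  add_mem' := by
    rintro f g ⟨F, hF, hFf⟩ ⟨G, hG, hGg⟩
    exact ⟨F + G, hF.add hG, fun x => by simp [hFf, hGg]⟩
  algebraMap_mem' r := ⟨fun _ => r, contDiffOn_const, fun _ => rfl⟩

/-- Evaluation at a point. -/
def evalAt {U : Set E2} (x : U) : smoothRing U →ₐ[ℝ] ℝ :=
  (Pi.evalAlgHom ℝ (fun _ : U => ℝ) x).comp (smoothRing U).val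

theorem ext_evalAt {U : Set E2} {f g : smoothRing U} (h : ∀ x, evalAt x f = evalAt x g) :
    f = g := Subtype.ext (funext h)

/-- The element of the ring defined by a function that is smooth on `U`. -/
def toRing {U : Set E2} (F : E2 → ℝ) (hF : ContDiffOn ℝ ∞ F U) : smoothRing U :=
  ⟨fun x => F x, F, hF, fun _ => rfl⟩

@[simp] theorem evalAt_toRing {U : Set E2} {F : E2 → ℝ} (hF : ContDiffOn ℝ ∞ F U) (x : U) :
    evalAt x (toRing F hF) = F x := rfl

theorem exists_rep {U : Set E2} (f : smoothRing U) :
    ∃ F : E2 → ℝ, ContDiffOn ℝ ∞ F U ∧ ∀ x : U, F x = evalAt x f := f.2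

theorem contDiffOn_of_rep {U : Set E2} {f : smoothRing U} {G : E2 → ℝ}
    (hG : ∀ x : U, G x = evalAt x f) : ContDiffOn ℝ ∞ G U := by
  obtain ⟨F, hF, hFf⟩ := exists_rep f
  exact hF.congr fun x hx => (hG ⟨x, hx⟩).trans (hFf ⟨x, hx⟩).symm

theorem differentiableAt_of_contDiffOn {E F : Type*} [NormedAddCommGroup E] [NormedSpace ℝ E]
    [NormedAddCommGroup F] [NormedSpace ℝ F] {f : E → F} {U : Set E} (hU : IsOpen U)
    (hf : ContDiffOn ℝ ∞ f U) {x : E} (hx : x ∈ U) : DifferentiableAt ℝ f x :=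
  (hf.contDiffAt (hU.mem_nhds hx)).differentiableAt (by simp)

theorem contDiffOn_fderiv_apply {E F : Type*} [NormedAddCommGroup E] [NormedSpace ℝ E]
    [NormedAddCommGroup F] [NormedSpace ℝ F] {f : E → F} {v : E → E} {U : Set E} (hU : IsOpen U)
    (hf : ContDiffOn ℝ ∞ f U) (hv : ContDiffOn ℝ ∞ v U) :
    ContDiffOn ℝ ∞ (fun x => fderiv ℝ f x (v x)) U :=
  (hf.fderiv_of_isOpen hU (m := ∞) (by simp)).clm_apply hv

theorem fderiv_fderiv_apply {E F : Type*} [NormedAddCommGroup E] [NormedSpace ℝ E]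
    [NormedAddCommGroup F] [NormedSpace ℝ F] {f : E → F} {v : E → E} {U : Set E} (hU : IsOpen U)
    (hf : ContDiffOn ℝ ∞ f U) (hv : ContDiffOn ℝ ∞ v U) {x : E} (hx : x ∈ U) (w : E) :
    fderiv ℝ (fun y => fderiv ℝ f y (v y)) x w =
      fderiv ℝ (fderiv ℝ f) x w (v x) + fderiv ℝ f x (fderiv ℝ v x w) := by
  have h1 : DifferentiableAt ℝ (fderiv ℝ f) x :=
    differentiableAt_of_contDiffOn hU (hf.fderiv_of_isOpen hU (m := ∞) (by simp)) hx
  have h2 : DifferentiableAt ℝ v x := differentiableAt_of_contDiffOn hU hv hx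
  rw [fderiv_clm_apply h1 h2]
  simp [add_comm]

theorem fderiv_fderiv_comm {E F : Type*} [NormedAddCommGroup E] [NormedSpace ℝ E]
    [NormedAddCommGroup F] [NormedSpace ℝ F] {f : E → F} {U : Set E} (hU : IsOpen U)
    (hf : ContDiffOn ℝ ∞ f U) {x : E} (hx : x ∈ U) (v w : E) :
    fderiv ℝ (fderiv ℝ f) x v w = fderiv ℝ (fderiv ℝ f) x w v :=
  ((hf.contDiffAt (hU.mem_nhds hx)).isSymmSndFDerivAt
    (by rw [minSmoothness_of_isRCLikeNormedField]; exact WithTop.coe_le_coe.mpr (le_top : (2 : ℕ∞) ≤ ⊤))) v w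

section VecDeriv

variable {U : Set E2} (hU : IsOpen U) {v : E2 → E2} (hv : ContDiffOn ℝ ∞ v U)

/-- Representatives of a ring element agree on the open set `U`, so the derivative at a point of `U`
does not depend on the choice. -/
theorem fderiv_eq_of_rep {U : Set E2} (hU : IsOpen U) {f : smoothRing U} {F G : E2 → ℝ}
    (hF : ∀ x : U, F x = evalAt x f) (hG : ∀ x : U, G x = evalAt x f) (x : U) :
    fderiv ℝ F x = fderiv ℝ G x := by
  refine Filter.EventuallyEq.fderiv_eq ?_
  filter_upwards [hU.mem_nhds x.2] with y hy
  rw [hF ⟨y, hy⟩, hG ⟨y, hy⟩]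

/-- The function `vf`, for a vector field `v`. -/
def vecDerivFun (f : smoothRing U) : smoothRing U :=
  toRing (fun x => fderiv ℝ (exists_rep f).choose x (v x))
    (contDiffOn_fderiv_apply hU (exists_rep f).choose_spec.1 hv)

theorem evalAt_vecDerivFun {f : smoothRing U} {G : E2 → ℝ} (hG : ∀ x : U, G x = evalAt x f)
    (x : U) : evalAt x (vecDerivFun hU hv f) = fderiv ℝ G x (v x) := by
  rw [vecDerivFun, evalAt_toRing, fderiv_eq_of_rep hU (exists_rep f).choose_spec.2 hG x]

/-- The derivation of the ring of smooth functions defined by a vector field. -/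
def vecDeriv : Derivation ℝ (smoothRing U) (smoothRing U) :=
  Derivation.mk'
    { toFun := vecDerivFun hU hv
      map_add' := by
        intro f g
        obtain ⟨F, hF, hFf⟩ := exists_rep f
        obtain ⟨G, hG, hGg⟩ := exists_rep g
        refine ext_evalAt fun x => ?_
        have h : ∀ y : U, (F + G) y = evalAt y (f + g) := fun y => by simp [hFf, hGg]
        rw [map_add, evalAt_vecDerivFun hU hv h, evalAt_vecDerivFun hU hv hFf,
          evalAt_vecDerivFun hU hv hGg, fderiv_add (differentiableAt_of_contDiffOn hU hF x.2)
            (differentiableAt_of_contDiffOn hU hG x.2)]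
        rfl
      map_smul' := by
        intro c f
        obtain ⟨F, hF, hFf⟩ := exists_rep f
        refine ext_evalAt fun x => ?_
        have h : ∀ y : U, (c • F) y = evalAt y (c • f) := fun y => by simp [hFf]
        rw [RingHom.id_apply, map_smul, evalAt_vecDerivFun hU hv h, evalAt_vecDerivFun hU hv hFf,
          fderiv_const_smul (differentiableAt_of_contDiffOn hU hF x.2)]
        rfl }
    (by
      intro f g
      obtain ⟨F, hF, hFf⟩ := exists_rep f
      obtain ⟨G, hG, hGg⟩ := exists_rep g
      refine ext_evalAt fun x => ?_
      have h : ∀ y : U, (F * G) y = evalAt y (f * g) := fun y => by simp [hFf, hGg]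
      simp only [LinearMap.coe_mk, AddHom.coe_mk, smul_eq_mul, map_add, map_mul]
      rw [evalAt_vecDerivFun hU hv h, evalAt_vecDerivFun hU hv hFf,
        evalAt_vecDerivFun hU hv hGg, fderiv_mul (differentiableAt_of_contDiffOn hU hF x.2)
          (differentiableAt_of_contDiffOn hU hG x.2), ← hFf, ← hGg]
      simp)

theorem evalAt_vecDeriv {f : smoothRing U} {G : E2 → ℝ} (hG : ∀ x : U, G x = evalAt x f)
    (x : U) : evalAt x (vecDeriv hU hv f) = fderiv ℝ G x (v x) :=
  evalAt_vecDerivFun hU hv hG x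

/-- By symmetry of the second derivative, the commutator is differentiation along the Lie bracket,
whose expansion in the frame is the hypothesis. -/
theorem vecDeriv_bracket {v₁ v₂ : E2 → E2} (h₁ : ContDiffOn ℝ ∞ v₁ U) (h₂ : ContDiffOn ℝ ∞ v₂ U)
    {α β : smoothRing U} (hαβ : ∀ x : U, fderiv ℝ v₂ x (v₁ x) - fderiv ℝ v₁ x (v₂ x) =
      evalAt x α • v₁ x + evalAt x β • v₂ x) (f : smoothRing U) :
    vecDeriv hU h₁ (vecDeriv hU h₂ f) - vecDeriv hU h₂ (vecDeriv hU h₁ f) =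
      α * vecDeriv hU h₁ f + β * vecDeriv hU h₂ f := by
  obtain ⟨F, hF, hFf⟩ := exists_rep f
  refine ext_evalAt fun x => ?_
  rw [map_sub, map_add, map_mul, map_mul,
    evalAt_vecDeriv hU h₁ (G := fun y => fderiv ℝ F y (v₂ y))
      (fun y => (evalAt_vecDeriv hU h₂ hFf y).symm),
    evalAt_vecDeriv hU h₂ (G := fun y => fderiv ℝ F y (v₁ y))
      (fun y => (evalAt_vecDeriv hU h₁ hFf y).symm),
    evalAt_vecDeriv hU h₁ hFf, evalAt_vecDeriv hU h₂ hFf,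
    fderiv_fderiv_apply hU hF h₂ x.2, fderiv_fderiv_apply hU hF h₁ x.2,
    fderiv_fderiv_comm hU hF x.2 (v₂ x) (v₁ x), add_sub_add_left_eq_sub, ← map_sub, hαβ, map_add,
    map_smul, map_smul, smul_eq_mul, smul_eq_mul]

end VecDeriv

/-! ### Pointwise geometry of an adapted frame -/

theorem qf_add_right (σ : ℝ) (u v w : Fin 3 → ℝ) : qf σ u (v + w) = qf σ u v + qf σ u w := by
  rw [qf_comm, qf_add_left, qf_comm σ v, qf_comm σ w]

theorem qf_sub_right (σ : ℝ) (u v w : Fin 3 → ℝ) : qf σ u (v - w) = qf σ u v - qf σ u w := by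
  rw [qf_comm, qf_sub_left, qf_comm σ v, qf_comm σ w]

theorem ip_eq (u w : V) : ip u w = qf 1 u.1 w.1 + qf (-1) u.2 w.2 := by
  rw [qf_one, qf_neg_one, ip]

theorem ip_comm (u w : V) : ip u w = ip w u := by
  rw [ip_eq, ip_eq, qf_comm, qf_comm (-1)]

theorem ip_add_left (u v w : V) : ip (u + v) w = ip u w + ip v w := by
  simp only [ip_eq, Prod.fst_add, Prod.snd_add, qf_add_left]; ring

theorem ip_sub_left (u v w : V) : ip (u - v) w = ip u w - ip v w := by
  simp only [ip_eq, Prod.fst_sub, Prod.snd_sub, qf_sub_left]; ring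

theorem ip_smul_left (c : ℝ) (u w : V) : ip (c • u) w = c * ip u w := by
  simp only [ip_eq, Prod.smul_fst, Prod.smul_snd, qf_smul_left]; ring

theorem ip_add_right (u v w : V) : ip u (v + w) = ip u v + ip u w := by
  rw [ip_comm, ip_add_left, ip_comm v, ip_comm w]

theorem ip_sub_right (u v w : V) : ip u (v - w) = ip u v - ip u w := by
  rw [ip_comm, ip_sub_left, ip_comm v, ip_comm w]

theorem ip_smul_right (c : ℝ) (u w : V) : ip u (c • w) = c * ip u w := by
  rw [ip_comm, ip_smul_left, ip_comm]

/-- The normal vector `F E - A E`. -/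
def nuVec (A : ℝ) (E : V) : V := ((1 - A) • E.1, -(1 + A) • E.2)

/-- The frame `v₁, v₂` at `x` diagonalizes the metrics pulled back from the two factors, and is
normalized. -/
structure IsAdaptedFrame (X : E2 → V) (x v₁ v₂ : E2) (A B : ℝ) : Prop where
  fst_self : qf 1 (X x).1 (X x).1 = 1
  snd_self : qf (-1) (X x).2 (X x).2 = -1
  fst_tangent : ∀ w, qf 1 (X x).1 (fderiv ℝ X x w).1 = 0
  snd_tangent : ∀ w, qf (-1) (X x).2 (fderiv ℝ X x w).2 = 0
  fst_orth : qf 1 (fderiv ℝ X x v₁).1 (fderiv ℝ X x v₂).1 = 0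
  snd_orth : qf (-1) (fderiv ℝ X x v₁).2 (fderiv ℝ X x v₂).2 = 0
  fst_norm₁ : 2 * (1 - A) * qf 1 (fderiv ℝ X x v₁).1 (fderiv ℝ X x v₁).1 = 1
  snd_norm₁ : 2 * (1 + A) * qf (-1) (fderiv ℝ X x v₁).2 (fderiv ℝ X x v₁).2 = 1
  fst_norm₂ : 2 * (1 - B) * qf 1 (fderiv ℝ X x v₂).1 (fderiv ℝ X x v₂).1 = 1
  snd_norm₂ : 2 * (1 + B) * qf (-1) (fderiv ℝ X x v₂).2 (fderiv ℝ X x v₂).2 = 1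
  sq_lt₁ : A ^ 2 < 1
  sq_lt₂ : B ^ 2 < 1

namespace IsAdaptedFrame

variable {X : E2 → V} {x v₁ v₂ : E2} {A B : ℝ}

theorem symm (h : IsAdaptedFrame X x v₁ v₂ A B) : IsAdaptedFrame X x v₂ v₁ B A where
  fst_self := h.fst_self
  snd_self := h.snd_self
  fst_tangent := h.fst_tangent
  snd_tangent := h.snd_tangent
  fst_orth := by rw [qf_comm, h.fst_orth]
  snd_orth := by rw [qf_comm, h.snd_orth]
  fst_norm₁ := h.fst_norm₂
  snd_norm₁ := h.snd_norm₂
  fst_norm₂ := h.fst_norm₁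
  snd_norm₂ := h.snd_norm₁
  sq_lt₁ := h.sq_lt₂
  sq_lt₂ := h.sq_lt₁

theorem pos (h : IsAdaptedFrame X x v₁ v₂ A B) : 0 < 1 - A ∧ 0 < 1 + A := by
  have := abs_lt.mp ((sq_lt_one_iff_abs_lt_one A).mp h.sq_lt₁)
  constructor <;> linarith

theorem fst_eq (h : IsAdaptedFrame X x v₁ v₂ A B) :
    qf 1 (fderiv ℝ X x v₁).1 (fderiv ℝ X x v₁).1 = 1 / (2 * (1 - A)) := by
  have := h.pos.1
  field_simp
  linear_combination h.fst_norm₁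

theorem snd_eq (h : IsAdaptedFrame X x v₁ v₂ A B) :
    qf (-1) (fderiv ℝ X x v₁).2 (fderiv ℝ X x v₁).2 = 1 / (2 * (1 + A)) := by
  have := h.pos.2
  field_simp
  linear_combination h.snd_norm₁

theorem metric_self (h : IsAdaptedFrame X x v₁ v₂ A B) : metric X x v₁ v₁ = 1 / (1 - A ^ 2) := by
  obtain ⟨h1, h2⟩ := h.pos
  rw [metric, ip_eq, h.fst_eq, h.snd_eq, show 1 - A ^ 2 = (1 - A) * (1 + A) by ring]
  field_simp
  ring

theorem metric_orth (h : IsAdaptedFrame X x v₁ v₂ A B) : metric X x v₁ v₂ = 0 := by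
  rw [metric, ip_eq, h.fst_orth, h.snd_orth, add_zero]

theorem one_sub_sq_ne (h : IsAdaptedFrame X x v₁ v₂ A B) : 1 - A ^ 2 ≠ 0 := by
  have := h.sq_lt₁
  exact (by linarith : 0 < 1 - A ^ 2).ne'

/-- The induced metric as a bilinear form. -/
def metricBilin (X : E2 → V) (x : E2) : LinearMap.BilinForm ℝ E2 :=
  LinearMap.mk₂ ℝ (metric X x)
    (fun u v w => by simp only [metric, map_add, ip_add_left])
    (fun c u w => by simp only [metric, map_smul, ip_smul_left, smul_eq_mul])
    (fun u v w => by simp only [metric, map_add, ip_add_right])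
    (fun c u w => by simp only [metric, map_smul, ip_smul_right, smul_eq_mul])

@[simp] theorem metricBilin_apply (X : E2 → V) (x v w : E2) :
    metricBilin X x v w = metric X x v w := rfl

theorem eq_combination (h : IsAdaptedFrame X x v₁ v₂ A B) (w : E2) :
    w = ((1 - A ^ 2) * metric X x w v₁) • v₁ + ((1 - B ^ 2) * metric X x w v₂) • v₂ := by
  have hA := h.one_sub_sq_ne
  have hB := h.symm.one_sub_sq_ne
  have := eq_sum_of_orthogonal (metricBilin X x) ![v₁, v₂] (by simp)
    (by
      intro i j hij
      fin_cases i <;> fin_cases j <;>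
        simp_all [h.metric_orth, h.symm.metric_orth])
    (by
      intro i
      fin_cases i <;>
        simp [h.metric_self, h.symm.metric_self, hA, hB]) w
  simp only [Fin.sum_univ_two, metricBilin_apply, Matrix.cons_val_zero,
    Matrix.cons_val_one, h.metric_self, h.symm.metric_self] at this
  rw [div_div_eq_mul_div, div_div_eq_mul_div, div_one, div_one] at this
  rw [mul_comm (1 - A ^ 2), mul_comm (1 - B ^ 2)]
  exact this

theorem eq_sum_basisVec (w : E2) : w = ∑ i, w i • basisVec i := by
  ext j
  fin_cases j <;> simp [basisVec, Fin.sum_univ_two]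

/-- The vectors `v₁, v₂` are orthogonal with squared lengths `1 / (1 - A ^ 2)` and `1 / (1 - B ^
2)`, so the inverse metric is the weighted sum of their tensor squares. Traces and tangential parts
can then be computed in the frame. -/
theorem gram_inv (h : IsAdaptedFrame X x v₁ v₂ A B) (i j : Fin 2) :
    (gram X x)⁻¹ i j = (1 - A ^ 2) * v₁ i * v₁ j + (1 - B ^ 2) * v₂ i * v₂ j := by
  suffices H : (gram X x)⁻¹ =
      Matrix.of fun i j => (1 - A ^ 2) * v₁ i * v₁ j + (1 - B ^ 2) * v₂ i * v₂ j by rw [H]; rfl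
  refine Matrix.inv_eq_left_inv ?_
  ext i k
  have h1 : ∀ w, metric X x w (basisVec k) = w 0 * metric X x (basisVec 0) (basisVec k) +
      w 1 * metric X x (basisVec 1) (basisVec k) := by
    intro w
    conv_lhs => rw [eq_sum_basisVec w]
    simp only [metric, Fin.sum_univ_two, map_smul, ip_add_left, ip_smul_left, map_add]
  have h2 := congrArg (fun u : E2 => u i) (h.eq_combination (basisVec k))
  have h3 : ∀ w, metric X x (basisVec k) w = metric X x w (basisVec k) := fun w => ip_comm _ _
  simp only [h3, h1 v₁, h1 v₂, PiLp.add_apply, PiLp.smul_apply, smul_eq_mul] at h2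
  simp only [Matrix.mul_apply, Fin.sum_univ_two, Matrix.of_apply, gram]
  have h4 : (1 : Matrix (Fin 2) (Fin 2) ℝ) i k = (basisVec k : E2) i := by
    simp [basisVec, Matrix.one_apply]
  rw [h4]
  linear_combination -h2

theorem sum_gram_inv (h : IsAdaptedFrame X x v₁ v₂ A B) {W : Type*} [AddCommGroup W] [Module ℝ W]
    (T : E2 →ₗ[ℝ] E2 →ₗ[ℝ] W) :
    ∑ i, ∑ j, (gram X x)⁻¹ i j • T (basisVec i) (basisVec j) =
      (1 - A ^ 2) • T v₁ v₁ + (1 - B ^ 2) • T v₂ v₂ := by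
  conv_rhs => rw [eq_sum_basisVec v₁, eq_sum_basisVec v₂]
  simp only [h.gram_inv, map_smul, Fin.sum_univ_two, LinearMap.add_apply,
    LinearMap.smul_apply, map_add]
  module

theorem tanPart_eq (h : IsAdaptedFrame X x v₁ v₂ A B) (u : V) :
    tanPart X x u = ((1 - A ^ 2) * ip u (fderiv ℝ X x v₁)) • fderiv ℝ X x v₁ +
      ((1 - B ^ 2) * ip u (fderiv ℝ X x v₂)) • fderiv ℝ X x v₂ := by
  have := h.sum_gram_inv (LinearMap.mk₂ ℝ (fun v w => ip u (fderiv ℝ X x v) • fderiv ℝ X x w)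
    (fun v v' w => by rw [map_add, ip_add_right, add_smul])
    (fun c v w => by rw [map_smul, ip_smul_right, mul_smul])
    (fun v w w' => by rw [map_add, smul_add])
    (fun c v w => by rw [map_smul, smul_comm]))
  simp only [LinearMap.mk₂_apply, smul_smul] at this
  exact this

theorem ip_nuVec (u : V) (A : ℝ) (E : V) :
    ip u (nuVec A E) = (1 - A) * qf 1 u.1 E.1 - (1 + A) * qf (-1) u.2 E.2 := by
  rw [ip_eq, nuVec]
  simp only [qf_smul_right]
  ring

theorem ip_tangent_nuVec (h : IsAdaptedFrame X x v₁ v₂ A B) (w : E2) :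
    ip (fderiv ℝ X x w) (nuVec A (fderiv ℝ X x v₁)) = 0 := by
  obtain ⟨h1, h2⟩ := h.pos
  rw [h.eq_combination w, map_add, map_smul, map_smul, ip_add_left, ip_smul_left, ip_smul_left,
    ip_nuVec, ip_nuVec, qf_comm 1 (fderiv ℝ X x v₂).1, qf_comm (-1) (fderiv ℝ X x v₂).2,
    h.fst_orth, h.snd_orth, h.fst_eq, h.snd_eq]
  field_simp
  ring

theorem ip_nuVec_self (h : IsAdaptedFrame X x v₁ v₂ A B) :
    ip (nuVec A (fderiv ℝ X x v₁)) (nuVec A (fderiv ℝ X x v₁)) = 1 := by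
  obtain ⟨h1, h2⟩ := h.pos
  rw [ip_nuVec, nuVec]
  simp only [qf_smul_left, h.fst_eq, h.snd_eq]
  field_simp
  ring

theorem ip_nuVec_nuVec (h : IsAdaptedFrame X x v₁ v₂ A B) :
    ip (nuVec A (fderiv ℝ X x v₁)) (nuVec B (fderiv ℝ X x v₂)) = 0 := by
  rw [ip_nuVec, nuVec]
  simp only [qf_smul_left, h.fst_orth, h.snd_orth]
  ring

theorem norPart_tangent (h : IsAdaptedFrame X x v₁ v₂ A B) (w : E2) :
    norPart X x (fderiv ℝ X x w) = 0 := by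
  rw [norPart, h.tanPart_eq]
  conv_lhs => enter [1]; rw [h.eq_combination w, map_add, map_smul, map_smul]
  simp [metric]

theorem ip_norPart_nuVec (h : IsAdaptedFrame X x v₁ v₂ A B) (u : V) :
    ip (norPart X x u) (nuVec A (fderiv ℝ X x v₁)) = ip u (nuVec A (fderiv ℝ X x v₁)) := by
  rw [norPart, ip_sub_left, h.tanPart_eq, ip_add_left, ip_smul_left, ip_smul_left,
    h.ip_tangent_nuVec, h.ip_tangent_nuVec]
  ring

theorem ip_norPart_frame (h : IsAdaptedFrame X x v₁ v₂ A B) (u : V) :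
    ip (norPart X x u) (fderiv ℝ X x v₁) = 0 := by
  have h1 := h.metric_self
  have h2 := h.symm.metric_orth
  have h3 := h.one_sub_sq_ne
  rw [metric] at h1 h2
  rw [norPart, ip_sub_left, h.tanPart_eq, ip_add_left, ip_smul_left, ip_smul_left, h1, h2]
  field_simp
  ring

theorem ip_ambProj_nuVec (h : IsAdaptedFrame X x v₁ v₂ A B) (u : V) :
    ip (ambProj (X x) u) (nuVec A (fderiv ℝ X x v₁)) = ip u (nuVec A (fderiv ℝ X x v₁)) := by
  simp only [ip_nuVec, ambProj, qf_sub_left, qf_add_left, qf_smul_left, h.fst_tangent,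
    h.snd_tangent]
  ring

theorem fst_ambProj (h : IsAdaptedFrame X x v₁ v₂ A B) (u : V) :
    qf 1 (X x).1 (ambProj (X x) u).1 = 0 := by
  rw [ambProj, ← qf_one, qf_comm, qf_sub_left, qf_smul_left, h.fst_self, qf_comm]
  ring

theorem snd_ambProj (h : IsAdaptedFrame X x v₁ v₂ A B) (u : V) :
    qf (-1) (X x).2 (ambProj (X x) u).2 = 0 := by
  rw [ambProj, ← qf_neg_one, qf_comm, qf_add_left, qf_smul_left, h.snd_self, qf_comm]
  ring

theorem fst_norPart (h : IsAdaptedFrame X x v₁ v₂ A B) {u : V} (hu : qf 1 (X x).1 u.1 = 0) :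
    qf 1 (X x).1 (norPart X x u).1 = 0 := by
  rw [norPart, h.tanPart_eq]
  simp only [Prod.fst_sub, Prod.fst_add, Prod.smul_fst, qf_sub_right, qf_add_right, qf_smul_right,
    hu, h.fst_tangent]
  ring

theorem snd_norPart (h : IsAdaptedFrame X x v₁ v₂ A B) {u : V} (hu : qf (-1) (X x).2 u.2 = 0) :
    qf (-1) (X x).2 (norPart X x u).2 = 0 := by
  rw [norPart, h.tanPart_eq]
  simp only [Prod.snd_sub, Prod.snd_add, Prod.smul_snd, qf_sub_right, qf_add_right, qf_smul_right,
    hu, h.snd_tangent]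
  ring

/-- A normal vector is a combination of the two vectors of the normal frame. -/
theorem eq_of_normal (h : IsAdaptedFrame X x v₁ v₂ A B) {n : V} (h1 : qf 1 (X x).1 n.1 = 0)
    (h2 : qf (-1) (X x).2 n.2 = 0) (h3 : ip n (fderiv ℝ X x v₁) = 0)
    (h4 : ip n (fderiv ℝ X x v₂) = 0) :
    n = ip n (nuVec A (fderiv ℝ X x v₁)) • nuVec A (fderiv ℝ X x v₁) +
      ip n (nuVec B (fderiv ℝ X x v₂)) • nuVec B (fderiv ℝ X x v₂) := by
  obtain ⟨hA1, hA2⟩ := h.pos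
  obtain ⟨hB1, hB2⟩ := h.symm.pos
  have e1 := eq_sum_of_qf_orthogonal (h.fst_tangent v₁) (h.fst_tangent v₂) h.fst_orth
    (by rw [h.fst_self]; exact one_ne_zero) (by rw [h.fst_eq]; positivity)
    (by rw [h.symm.fst_eq]; positivity) n.1
  have e2 := eq_sum_of_qf_orthogonal (h.snd_tangent v₁) (h.snd_tangent v₂) h.snd_orth
    (by rw [h.snd_self]; norm_num) (by rw [h.snd_eq]; positivity)
    (by rw [h.symm.snd_eq]; positivity) n.2
  rw [qf_comm, h1, h.fst_eq, h.symm.fst_eq] at e1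
  rw [qf_comm, h2, h.snd_eq, h.symm.snd_eq] at e2
  rw [ip_eq] at h3 h4
  rw [ip_nuVec, ip_nuVec]
  -- Orthogonality to `v₁` and `v₂` makes the components in the second factor opposite to those in
  -- the first, so two numbers determine the vector.
  have k1 : qf (-1) n.2 (fderiv ℝ X x v₁).2 = -qf 1 n.1 (fderiv ℝ X x v₁).1 := by linarith
  have k2 : qf (-1) n.2 (fderiv ℝ X x v₂).2 = -qf 1 n.1 (fderiv ℝ X x v₂).1 := by linarith
  rw [k1, k2] at e2 ⊢
  refine Prod.ext ?_ ?_
  · conv_lhs => rw [e1]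
    simp only [nuVec, Prod.fst_add, Prod.smul_fst, smul_smul, zero_div, zero_smul, zero_add,
      div_div_eq_mul_div, div_one]
    congr 2 <;> ring
  · conv_lhs => rw [e2]
    simp only [nuVec, Prod.snd_add, Prod.smul_snd, smul_smul, zero_div, zero_smul, zero_add,
      div_div_eq_mul_div, div_one]
    congr 2 <;> ring

end IsAdaptedFrame

/-! ### The second fundamental form in a smooth adapted frame -/

theorem evalAt_comp_dvec {U : Set E2} (hU : IsOpen U) {v : E2 → E2} (hv : ContDiffOn ℝ ∞ v U)
    {u : Fin 3 → smoothRing U} {G : E2 → Fin 3 → ℝ} (hG : ∀ x : U, G x = evalAt x ∘ u) (x : U) :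
    evalAt x ∘ dvec (vecDeriv hU hv) u = fderiv ℝ G x (v x) := by
  have h1 : ∀ k, ∀ y : U, (fun z => G z k) y = evalAt y (u k) := fun k y => congrFun (hG y) k
  have h2 : ContDiffOn ℝ ∞ G U := contDiffOn_pi.mpr fun k => contDiffOn_of_rep (h1 k)
  ext k
  rw [Function.comp_apply, dvec, evalAt_vecDeriv hU hv (G := fun z => G z k) (h1 k),
    fderiv_apply (differentiableAt_of_contDiffOn hU h2 x.2)]
  rfl

/-- `norPart` as a linear map. -/
def norLin (X : E2 → V) (x : E2) : V →ₗ[ℝ] V where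
  toFun := norPart X x
  map_add' u w := by
    simp only [norPart, tanPart, ip_add_left, mul_add, add_smul, Finset.sum_add_distrib]
    abel
  map_smul' c u := by
    simp only [norPart, tanPart, ip_smul_left, RingHom.id_apply, smul_sub, Finset.smul_sum,
      smul_smul]
    simp only [mul_left_comm]

@[simp] theorem norLin_apply (X : E2 → V) (x : E2) (u : V) : norLin X x u = norPart X x u := rfl

/-- `ambProj` as a linear map. -/
def ambLin (P : V) : V →ₗ[ℝ] V where
  toFun := ambProj P
  map_add' u w := by
    simp only [ambProj, ← qf_one, ← qf_neg_one, Prod.fst_add, Prod.snd_add, qf_add_right]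
    ext <;> simp <;> ring
  map_smul' c u := by
    simp only [ambProj, ← qf_one, ← qf_neg_one, Prod.smul_fst, Prod.smul_snd, qf_smul_right]
    ext <;> simp <;> ring

@[simp] theorem ambLin_apply (P u : V) : ambLin P u = ambProj P u := rfl

/-- The second fundamental form as a bilinear map. -/
def sffBilin (X : E2 → V) (x : E2) : E2 →ₗ[ℝ] E2 →ₗ[ℝ] V :=
  LinearMap.mk₂ ℝ (fun v w => norLin X x (ambLin (X x) (fderiv ℝ (fderiv ℝ X) x v w)))
    (fun v v' w => by simp only [map_add, add_apply])
    (fun c v w => by simp only [map_smul, smul_apply])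
    (fun v w w' => by simp only [map_add])
    (fun c v w => by simp only [map_smul])

section Local

variable {U : Set E2} {X : E2 → V}

theorem secondFF_eq_sffBilin (hU : IsOpen U) (hX : ContDiffOn ℝ ∞ X U) {x : E2} (hx : x ∈ U)
    (v w : E2) : secondFF X x v w = sffBilin X x v w := by
  have := fderiv_fderiv_apply hU hX (v := fun _ => w) contDiffOn_const hx v
  rw [secondFF, covDeriv, this]
  simp [sffBilin]

theorem ambProj_tangent {x v₁ v₂ : E2} {A B : ℝ} (h : IsAdaptedFrame X x v₁ v₂ A B) (w : E2) :
    ambProj (X x) (fderiv ℝ X x w) = fderiv ℝ X x w := by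
  rw [ambProj, ← qf_one, ← qf_neg_one, h.fst_tangent, h.snd_tangent]
  simp

/-- Replacing the constant extension by the field `w` adds `dX` of the derivative of `w`, which is
tangent and has no normal part. -/
theorem secondFF_field (hU : IsOpen U) (hX : ContDiffOn ℝ ∞ X U) {x v₁ v₂ : E2} {A B : ℝ}
    (hx : x ∈ U) (h : IsAdaptedFrame X x v₁ v₂ A B) {w : E2 → E2} (hw : ContDiffOn ℝ ∞ w U)
    (v : E2) : secondFF X x v (w x) =
      norPart X x (ambProj (X x) (fderiv ℝ (fun y => fderiv ℝ X y (w y)) x v)) := by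
  rw [secondFF_eq_sffBilin hU hX hx, fderiv_fderiv_apply hU hX hw hx]
  have h1 : ambProj (X x) (fderiv ℝ (fderiv ℝ X) x v (w x) + fderiv ℝ X x (fderiv ℝ w x v)) =
      ambProj (X x) (fderiv ℝ (fderiv ℝ X) x v (w x)) + fderiv ℝ X x (fderiv ℝ w x v) := by
    rw [← ambLin_apply, map_add, ambLin_apply, ambLin_apply, ambProj_tangent h]
  rw [h1, ← norLin_apply, map_add, norLin_apply X x (fderiv ℝ X x _), h.norPart_tangent, add_zero]
  rfl

theorem norPart_ambProj_eq {x v₁ v₂ : E2} {A B : ℝ} (h : IsAdaptedFrame X x v₁ v₂ A B) (u : V) :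
    norPart X x (ambProj (X x) u) =
      ip u (nuVec A (fderiv ℝ X x v₁)) • nuVec A (fderiv ℝ X x v₁) +
        ip u (nuVec B (fderiv ℝ X x v₂)) • nuVec B (fderiv ℝ X x v₂) := by
  have := h.eq_of_normal (h.fst_norPart (h.fst_ambProj u)) (h.snd_norPart (h.snd_ambProj u))
    (h.ip_norPart_frame _) (h.symm.ip_norPart_frame _)
  rw [h.ip_norPart_nuVec, h.symm.ip_norPart_nuVec, h.ip_ambProj_nuVec, h.symm.ip_ambProj_nuVec]
    at this
  exact this

theorem meanCurv_eq (hU : IsOpen U) (hX : ContDiffOn ℝ ∞ X U) {x v₁ v₂ : E2} {A B : ℝ}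
    (hx : x ∈ U) (h : IsAdaptedFrame X x v₁ v₂ A B) :
    meanCurv X x = (1 / 2 : ℝ) • ((1 - A ^ 2) • secondFF X x v₁ v₁ +
      (1 - B ^ 2) • secondFF X x v₂ v₂) := by
  simp only [meanCurv, secondFF_eq_sffBilin hU hX hx, h.sum_gram_inv]

theorem fst_fderiv {f : E2 → V} {x : E2} (hf : DifferentiableAt ℝ f x) (w : E2) :
    (fderiv ℝ f x w).1 = fderiv ℝ (fun y => (f y).1) x w := by
  rw [fderiv.fst hf]; rfl

theorem snd_fderiv {f : E2 → V} {x : E2} (hf : DifferentiableAt ℝ f x) (w : E2) :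
    (fderiv ℝ f x w).2 = fderiv ℝ (fun y => (f y).2) x w := by
  rw [fderiv.snd hf]; rfl

/-- The coordinates of `X` in the first factor. -/
def coordFst (hX : ContDiffOn ℝ ∞ X U) (k : Fin 3) : smoothRing U :=
  toRing (fun x => (X x).1 k) (contDiffOn_pi.mp (contDiff_fst.comp_contDiffOn hX) k)

/-- The coordinates of `X` in the second factor. -/
def coordSnd (hX : ContDiffOn ℝ ∞ X U) (k : Fin 3) : smoothRing U :=
  toRing (fun x => (X x).2 k) (contDiffOn_pi.mp (contDiff_snd.comp_contDiffOn hX) k)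

theorem evalAt_coordFst (hX : ContDiffOn ℝ ∞ X U) (x : U) :
    evalAt x ∘ coordFst hX = (X x).1 := rfl

theorem evalAt_coordSnd (hX : ContDiffOn ℝ ∞ X U) (x : U) :
    evalAt x ∘ coordSnd hX = (X x).2 := rfl

section

variable (hU : IsOpen U) (hX : ContDiffOn ℝ ∞ X U) {v w : E2 → E2} (hv : ContDiffOn ℝ ∞ v U)
  (hw : ContDiffOn ℝ ∞ w U) (x : U)

theorem evalAt_dvec_coordFst :
    evalAt x ∘ dvec (vecDeriv hU hv) (coordFst hX) = (fderiv ℝ X x (v x)).1 := by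
  rw [evalAt_comp_dvec hU hv (G := fun y => (X y).1) (fun y => (evalAt_coordFst hX y).symm),
    fst_fderiv (differentiableAt_of_contDiffOn hU hX x.2)]

theorem evalAt_dvec_coordSnd :
    evalAt x ∘ dvec (vecDeriv hU hv) (coordSnd hX) = (fderiv ℝ X x (v x)).2 := by
  rw [evalAt_comp_dvec hU hv (G := fun y => (X y).2) (fun y => (evalAt_coordSnd hX y).symm),
    snd_fderiv (differentiableAt_of_contDiffOn hU hX x.2)]

theorem evalAt_dvec_dvec_coordFst :
    evalAt x ∘ dvec (vecDeriv hU hv) (dvec (vecDeriv hU hw) (coordFst hX)) =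
      (fderiv ℝ (fun y => fderiv ℝ X y (w y)) x (v x)).1 := by
  rw [evalAt_comp_dvec hU hv (G := fun y => (fderiv ℝ X y (w y)).1)
    (fun y => (evalAt_dvec_coordFst hU hX hw y).symm),
    fst_fderiv (differentiableAt_of_contDiffOn hU (contDiffOn_fderiv_apply hU hX hw) x.2)]

theorem evalAt_dvec_dvec_coordSnd :
    evalAt x ∘ dvec (vecDeriv hU hv) (dvec (vecDeriv hU hw) (coordSnd hX)) =
      (fderiv ℝ (fun y => fderiv ℝ X y (w y)) x (v x)).2 := by
  rw [evalAt_comp_dvec hU hv (G := fun y => (fderiv ℝ X y (w y)).2)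
    (fun y => (evalAt_dvec_coordSnd hU hX hw y).symm),
    snd_fderiv (differentiableAt_of_contDiffOn hU (contDiffOn_fderiv_apply hU hX hw) x.2)]

end

end Local

/-- The value of the Hopf differential on a pair of multiples of two vectors that are conjugate
for the product structure, in terms of the bilinear form `⟨h, H⟩`. -/
theorem hopf_smul {X : E2 → V} {x : E2} {T : E2 →ₗ[ℝ] E2 →ₗ[ℝ] V}
    (hT : ∀ v w, secondFF X x v w = T v w) (s t : ℝ) (v w : E2) :
    hopf X x (s • v) (t • w) =
      ⟨(s ^ 2 * ip (T v v) (meanCurv X x) - t ^ 2 * ip (T w w) (meanCurv X x)) +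
        (s ^ 2 * ip (prodStr (fderiv ℝ X x v)) (fderiv ℝ X x v) -
          t ^ 2 * ip (prodStr (fderiv ℝ X x w)) (fderiv ℝ X x w)) / 4,
      -(s * t) * ((ip (T v w) (meanCurv X x) + ip (T w v) (meanCurv X x)) +
        (ip (prodStr (fderiv ℝ X x v)) (fderiv ℝ X x w) +
          ip (prodStr (fderiv ℝ X x w)) (fderiv ℝ X x v)) / 4)⟩ := by
  have hp : ∀ (c : ℝ) (u : V), prodStr (c • u) = c • prodStr u := by
    intro c u; ext <;> simp [prodStr]
  apply Complex.ext <;>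
  · simp only [hopf, complexBilin, dz, hT, map_smul, LinearMap.smul_apply, ip_smul_left, hp,
      ip_smul_right, Complex.add_re, Complex.mul_re, Complex.add_im, Complex.mul_im,
      Complex.re_ofNat, Complex.im_ofNat]
    ring

/-! ### A smooth adapted frame cannot exist -/

theorem contDiffOn_ip {U : Set E2} {f g : E2 → V} (hf : ContDiffOn ℝ ∞ f U)
    (hg : ContDiffOn ℝ ∞ g U) : ContDiffOn ℝ ∞ (fun x => ip (f x) (g x)) U := by
  have f1 := contDiffOn_pi.mp (contDiff_fst.comp_contDiffOn hf)
  have f2 := contDiffOn_pi.mp (contDiff_snd.comp_contDiffOn hf)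
  have g1 := contDiffOn_pi.mp (contDiff_fst.comp_contDiffOn hg)
  have g2 := contDiffOn_pi.mp (contDiff_snd.comp_contDiffOn hg)
  simp only [ip_eq, qf, smul_eq_mul]
  exact ((((f1 0).mul (g1 0)).add ((f1 1).mul (g1 1))).add
    (contDiffOn_const.mul ((f1 2).mul (g1 2)))).add
    ((((f2 0).mul (g2 0)).add ((f2 1).mul (g2 1))).add
    (contDiffOn_const.mul ((f2 2).mul (g2 2))))

section

variable {U : Set E2} {X : E2 → V} {v₁ v₂ : E2 → E2} {A B : E2 → ℝ}
  (hU : IsOpen U) (hX : ContDiffOn ℝ ∞ X U) (h₁ : ContDiffOn ℝ ∞ v₁ U) (h₂ : ContDiffOn ℝ ∞ v₂ U) (hA : ContDiffOn ℝ ∞ A U)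
  (hB : ContDiffOn ℝ ∞ B U)

/-- The component along `w` of the Lie bracket of the two vector fields of the frame. -/
def bracketCoeff (w : E2 → E2) (C : E2 → ℝ) (hw : ContDiffOn ℝ ∞ w U) (hC : ContDiffOn ℝ ∞ C U) :
    smoothRing U :=
  toRing (fun x => (1 - C x ^ 2) *
      metric X x (fderiv ℝ v₂ x (v₁ x) - fderiv ℝ v₁ x (v₂ x)) (w x))
    ((contDiffOn_const.sub (hC.pow 2)).mul (contDiffOn_ip
      (contDiffOn_fderiv_apply hU hX
        ((contDiffOn_fderiv_apply hU h₂ h₁).sub (contDiffOn_fderiv_apply hU h₁ h₂)))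
      (contDiffOn_fderiv_apply hU hX hw)))

theorem frame_bracket
    (hfr : ∀ x ∈ U, IsAdaptedFrame X x (v₁ x) (v₂ x) (A x) (B x))
    (f : smoothRing U) :
    vecDeriv hU h₁ (vecDeriv hU h₂ f) - vecDeriv hU h₂ (vecDeriv hU h₁ f) =
      bracketCoeff hU hX h₁ h₂ v₁ A h₁ hA * vecDeriv hU h₁ f +
        bracketCoeff hU hX h₁ h₂ v₂ B h₂ hB * vecDeriv hU h₂ f :=
  vecDeriv_bracket hU h₁ h₂ (fun x => (hfr x x.2).eq_combination _) f

theorem isQuadricFrame_fst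
    (hfr : ∀ x ∈ U, IsAdaptedFrame X x (v₁ x) (v₂ x) (A x) (B x)) :
    IsQuadricFrame (evalAt (U := U)) (vecDeriv hU h₁) (vecDeriv hU h₂)
    (bracketCoeff hU hX h₁ h₂ v₁ A h₁ hA) (bracketCoeff hU hX h₁ h₂ v₂ B h₂ hB) 1
    (coordFst hX) (toRing A hA) (toRing B hB) where
  ext_ev _ _ := ext_evalAt
  bracket := frame_bracket hU hX h₁ h₂ hA hB hfr
  sigma_ne := one_ne_zero
  quadric := ext_evalAt fun x => by
    rw [map_qf, evalAt_coordFst, AlgHom.commutes]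
    exact (hfr x x.2).fst_self
  orth := ext_evalAt fun x => by
    rw [map_qf, evalAt_dvec_coordFst, evalAt_dvec_coordFst, (hfr x x.2).fst_orth, map_zero]
  norm₁ := ext_evalAt fun x => by
    simp only [map_mul, map_sub, map_one, map_ofNat, one_smul, map_qf, evalAt_dvec_coordFst,
      evalAt_toRing]
    exact (hfr x x.2).fst_norm₁
  norm₂ := ext_evalAt fun x => by
    simp only [map_mul, map_sub, map_one, map_ofNat, one_smul, map_qf, evalAt_dvec_coordFst,
      evalAt_toRing]
    exact (hfr x x.2).fst_norm₂

theorem isQuadricFrame_snd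
    (hfr : ∀ x ∈ U, IsAdaptedFrame X x (v₁ x) (v₂ x) (A x) (B x)) :
    IsQuadricFrame (evalAt (U := U)) (vecDeriv hU h₁) (vecDeriv hU h₂)
    (bracketCoeff hU hX h₁ h₂ v₁ A h₁ hA) (bracketCoeff hU hX h₁ h₂ v₂ B h₂ hB) (-1)
    (coordSnd hX) (toRing A hA) (toRing B hB) where
  ext_ev _ _ := ext_evalAt
  bracket := frame_bracket hU hX h₁ h₂ hA hB hfr
  sigma_ne := by norm_num
  quadric := ext_evalAt fun x => by
    rw [map_qf, evalAt_coordSnd, AlgHom.commutes]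
    exact (hfr x x.2).snd_self
  orth := ext_evalAt fun x => by
    rw [map_qf, evalAt_dvec_coordSnd, evalAt_dvec_coordSnd, (hfr x x.2).snd_orth, map_zero]
  norm₁ := ext_evalAt fun x => by
    simp only [map_mul, map_add, map_one, map_ofNat, map_qf, evalAt_dvec_coordSnd,
      evalAt_toRing, neg_smul, one_smul, sub_neg_eq_add]
    exact (hfr x x.2).snd_norm₁
  norm₂ := ext_evalAt fun x => by
    simp only [map_mul, map_add, map_one, map_ofNat, map_qf, evalAt_dvec_coordSnd,
      evalAt_toRing, neg_smul, one_smul, sub_neg_eq_add]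
    exact (hfr x x.2).snd_norm₂

theorem evalAt_sffOne {u v w : E2 → E2} (hu : ContDiffOn ℝ ∞ u U) (hv : ContDiffOn ℝ ∞ v U)
    (hw : ContDiffOn ℝ ∞ w U) (x : U) :
    evalAt x (sffOne (coordFst hX) (coordSnd hX) (toRing A hA) (vecDeriv hU hu) (vecDeriv hU hv)
      (vecDeriv hU hw)) = ip (fderiv ℝ (fun y => fderiv ℝ X y (w y)) x (v x))
        (nuVec (A x) (fderiv ℝ X x (u x))) := by
  simp only [sffOne, map_sub, map_mul, map_add, map_one, map_qf, evalAt_dvec_dvec_coordFst,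
    evalAt_dvec_dvec_coordSnd, evalAt_dvec_coordFst, evalAt_dvec_coordSnd, evalAt_toRing,
    IsAdaptedFrame.ip_nuVec]

theorem secondFF_frame
    (hfr : ∀ x ∈ U, IsAdaptedFrame X x (v₁ x) (v₂ x) (A x) (B x))
    {v w : E2 → E2} (hv : ContDiffOn ℝ ∞ v U)
    (hw : ContDiffOn ℝ ∞ w U) (x : U) :
    secondFF X x (v x) (w x) =
      evalAt x (sffOne (coordFst hX) (coordSnd hX) (toRing A hA) (vecDeriv hU h₁) (vecDeriv hU hv)
        (vecDeriv hU hw)) • nuVec (A x) (fderiv ℝ X x (v₁ x)) +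
      evalAt x (sffOne (coordFst hX) (coordSnd hX) (toRing B hB) (vecDeriv hU h₂) (vecDeriv hU hv)
        (vecDeriv hU hw)) • nuVec (B x) (fderiv ℝ X x (v₂ x)) := by
  rw [secondFF_field hU hX x.2 (hfr x x.2) hw, norPart_ambProj_eq (hfr x x.2), evalAt_sffOne,
    evalAt_sffOne]

theorem meanCurv_frame
    (hfr : ∀ x ∈ U, IsAdaptedFrame X x (v₁ x) (v₂ x) (A x) (B x))
    (x : U) :
    meanCurv X x =
      evalAt x (meanOne (coordFst hX) (coordSnd hX) (toRing A hA) (toRing B hB) (vecDeriv hU h₁)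
        (vecDeriv hU h₂)) • nuVec (A x) (fderiv ℝ X x (v₁ x)) -
      evalAt x (meanTwo (coordFst hX) (coordSnd hX) (toRing A hA) (toRing B hB) (vecDeriv hU h₁)
        (vecDeriv hU h₂)) • nuVec (B x) (fderiv ℝ X x (v₂ x)) := by
  rw [meanCurv_eq hU hX x.2 (hfr x x.2), secondFF_frame hU hX h₁ h₂ hA hB hfr h₁ h₁,
    secondFF_frame hU hX h₁ h₂ hA hB hfr h₂ h₂]
  simp only [meanOne, meanTwo, map_smul, map_add, map_mul, map_sub, map_pow, map_one,
    evalAt_toRing, smul_eq_mul]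
  module

/-- The frame expression of `H` has coefficients in the ring of smooth functions. It shows that `H`
is smooth on `U` and lets its derivative be computed by derivations. -/
theorem fderiv_meanCurv_frame
    (hfr : ∀ x ∈ U, IsAdaptedFrame X x (v₁ x) (v₂ x) (A x) (B x))
    {v : E2 → E2} (hv : ContDiffOn ℝ ∞ v U) (x : U) :
    (fderiv ℝ (meanCurv X) x (v x)).1 = evalAt x ∘ dvec (vecDeriv hU hv)
      (meanVecFst (coordFst hX) (toRing A hA) (toRing B hB)
        (meanOne (coordFst hX) (coordSnd hX) (toRing A hA) (toRing B hB) (vecDeriv hU h₁)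
          (vecDeriv hU h₂))
        (meanTwo (coordFst hX) (coordSnd hX) (toRing A hA) (toRing B hB) (vecDeriv hU h₁)
          (vecDeriv hU h₂)) (vecDeriv hU h₁) (vecDeriv hU h₂)) ∧
    (fderiv ℝ (meanCurv X) x (v x)).2 = evalAt x ∘ dvec (vecDeriv hU hv)
      (meanVecSnd (coordSnd hX) (toRing A hA) (toRing B hB)
        (meanOne (coordFst hX) (coordSnd hX) (toRing A hA) (toRing B hB) (vecDeriv hU h₁)
          (vecDeriv hU h₂))
        (meanTwo (coordFst hX) (coordSnd hX) (toRing A hA) (toRing B hB) (vecDeriv hU h₁)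
          (vecDeriv hU h₂)) (vecDeriv hU h₁) (vecDeriv hU h₂)) := by
  set p := meanOne (coordFst hX) (coordSnd hX) (toRing A hA) (toRing B hB) (vecDeriv hU h₁)
    (vecDeriv hU h₂) with hp
  set q := meanTwo (coordFst hX) (coordSnd hX) (toRing A hA) (toRing B hB) (vecDeriv hU h₁)
    (vecDeriv hU h₂) with hq
  have e1 : ∀ y : U, (fun z => (meanCurv X z).1) y = evalAt y ∘
      meanVecFst (coordFst hX) (toRing A hA) (toRing B hB) p q (vecDeriv hU h₁)
        (vecDeriv hU h₂) := by
    intro y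
    ext k
    have f1 := congrFun (evalAt_dvec_coordFst hU hX h₁ y) k
    have f2 := congrFun (evalAt_dvec_coordFst hU hX h₂ y) k
    rw [Function.comp_apply] at f1 f2
    simp only [meanCurv_frame hU hX h₁ h₂ hA hB hfr y, meanVecFst, nuVec, Function.comp_apply,
      Pi.sub_apply, Pi.smul_apply, smul_eq_mul, map_sub, map_mul, map_one, evalAt_toRing, f1, f2,
      Prod.fst_sub, Prod.smul_fst, ← hp, ← hq]
    ring
  have e2 : ∀ y : U, (fun z => (meanCurv X z).2) y = evalAt y ∘
      meanVecSnd (coordSnd hX) (toRing A hA) (toRing B hB) p q (vecDeriv hU h₁)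
        (vecDeriv hU h₂) := by
    intro y
    ext k
    have f1 := congrFun (evalAt_dvec_coordSnd hU hX h₁ y) k
    have f2 := congrFun (evalAt_dvec_coordSnd hU hX h₂ y) k
    rw [Function.comp_apply] at f1 f2
    simp only [meanCurv_frame hU hX h₁ h₂ hA hB hfr y, meanVecSnd, nuVec, Function.comp_apply,
      Pi.sub_apply, Pi.smul_apply, smul_eq_mul, map_sub, map_mul, map_one, map_add,
      evalAt_toRing, f1, f2, Prod.snd_sub, Prod.smul_snd, ← hp, ← hq]
    ring
  have d1 : ContDiffOn ℝ ∞ (fun z => (meanCurv X z).1) U :=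
    contDiffOn_pi.mpr fun k => contDiffOn_of_rep (G := fun z => (meanCurv X z).1 k)
      fun y => congrFun (e1 y) k
  have d2 : ContDiffOn ℝ ∞ (fun z => (meanCurv X z).2) U :=
    contDiffOn_pi.mpr fun k => contDiffOn_of_rep (G := fun z => (meanCurv X z).2 k)
      fun y => congrFun (e2 y) k
  have d : DifferentiableAt ℝ (meanCurv X) x :=
    differentiableAt_of_contDiffOn hU (d1.prodMk d2) x.2
  exact ⟨by rw [evalAt_comp_dvec hU hv (G := fun z => (meanCurv X z).1) e1, fst_fderiv d],
    by rw [evalAt_comp_dvec hU hv (G := fun z => (meanCurv X z).2) e2, snd_fderiv d]⟩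

theorem isParallelFrame
    (hfr : ∀ x ∈ U, IsAdaptedFrame X x (v₁ x) (v₂ x) (A x) (B x))
    (hpar : ∀ x ∈ U, ∀ v, normalDerivMeanCurv X x v = 0) :
    IsParallelFrame (evalAt (U := U)) (vecDeriv hU h₁) (vecDeriv hU h₂)
      (bracketCoeff hU hX h₁ h₂ v₁ A h₁ hA) (bracketCoeff hU hX h₁ h₂ v₂ B h₂ hB)
      (coordFst hX) (coordSnd hX) (toRing A hA) (toRing B hB)
      (meanOne (coordFst hX) (coordSnd hX) (toRing A hA) (toRing B hB) (vecDeriv hU h₁)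
        (vecDeriv hU h₂))
      (meanTwo (coordFst hX) (coordSnd hX) (toRing A hA) (toRing B hB) (vecDeriv hU h₁)
        (vecDeriv hU h₂)) := by
  have key : ∀ {v : E2 → E2}, ContDiffOn ℝ ∞ v U → ∀ x : U,
      ip (fderiv ℝ (meanCurv X) x (v x)) (nuVec (A x) (fderiv ℝ X x (v₁ x))) = 0 ∧
      ip (fderiv ℝ (meanCurv X) x (v x)) (nuVec (B x) (fderiv ℝ X x (v₂ x))) = 0 := by
    intro v hv x
    have h := hfr x x.2
    have h0 := hpar x x.2 (v x)
    rw [normalDerivMeanCurv, covDeriv] at h0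
    have hz : ∀ n, ip 0 n = 0 := fun n => by simpa using ip_smul_left 0 0 n
    constructor
    · rw [← h.ip_ambProj_nuVec, ← h.ip_norPart_nuVec, h0, hz]
    · rw [← h.symm.ip_ambProj_nuVec, ← h.symm.ip_norPart_nuVec, h0, hz]
  refine ⟨isQuadricFrame_fst hU hX h₁ h₂ hA hB hfr, isQuadricFrame_snd hU hX h₁ h₂ hA hB hfr,
    rfl, rfl, ?_, ?_⟩
  · rintro D (rfl | rfl)
    all_goals
      refine ext_evalAt fun x => ?_
      simp only [map_sub, map_mul, map_one, map_add, map_zero, map_qf, evalAt_dvec_coordFst,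
        evalAt_dvec_coordSnd, evalAt_toRing]
    · obtain ⟨f1, f2⟩ := fderiv_meanCurv_frame hU hX h₁ h₂ hA hB hfr h₁ x
      rw [← f1, ← f2, ← IsAdaptedFrame.ip_nuVec]
      exact (key h₁ x).1
    · obtain ⟨f1, f2⟩ := fderiv_meanCurv_frame hU hX h₁ h₂ hA hB hfr h₂ x
      rw [← f1, ← f2, ← IsAdaptedFrame.ip_nuVec]
      exact (key h₂ x).1
  · rintro D (rfl | rfl)
    all_goals
      refine ext_evalAt fun x => ?_
      simp only [map_sub, map_mul, map_one, map_add, map_zero, map_qf, evalAt_dvec_coordFst,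
        evalAt_dvec_coordSnd, evalAt_toRing]
    · obtain ⟨f1, f2⟩ := fderiv_meanCurv_frame hU hX h₁ h₂ hA hB hfr h₁ x
      rw [← f1, ← f2, ← IsAdaptedFrame.ip_nuVec]
      exact (key h₁ x).2
    · obtain ⟨f1, f2⟩ := fderiv_meanCurv_frame hU hX h₁ h₂ hA hB hfr h₂ x
      rw [← f1, ← f2, ← IsAdaptedFrame.ip_nuVec]
      exact (key h₂ x).2

theorem hopfFrame
    (hfr : ∀ x ∈ U, IsAdaptedFrame X x (v₁ x) (v₂ x) (A x) (B x))
    (hhopf : ∀ x ∈ U, ∀ v w, IsConformalPair X x v w → hopf X x v w = 0) :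
    HopfFrame (vecDeriv hU h₁) (vecDeriv hU h₂) (coordFst hX) (coordSnd hX) (toRing A hA)
      (toRing B hB)
      (meanOne (coordFst hX) (coordSnd hX) (toRing A hA) (toRing B hB) (vecDeriv hU h₁)
        (vecDeriv hU h₂))
      (meanTwo (coordFst hX) (coordSnd hX) (toRing A hA) (toRing B hB) (vecDeriv hU h₁)
        (vecDeriv hU h₂)) := by
  have key : ∀ x : U, (1 - A x ^ 2) * ip (secondFF X x (v₁ x) (v₁ x)) (meanCurv X x) -
      (1 - B x ^ 2) * ip (secondFF X x (v₂ x) (v₂ x)) (meanCurv X x) + (A x - B x) / 4 = 0 ∧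
      ip (secondFF X x (v₁ x) (v₂ x)) (meanCurv X x) +
        ip (secondFF X x (v₂ x) (v₁ x)) (meanCurv X x) = 0 := by
    intro x
    have h := hfr x x.2
    have hA0 : 0 < 1 - A x ^ 2 := by linarith [h.sq_lt₁]
    have hB0 : 0 < 1 - B x ^ 2 := by linarith [h.sq_lt₂]
    -- Scaling by the square roots of `1 - A ^ 2` and `1 - B ^ 2` makes the frame orthonormal, hence
    -- a conformal pair.
    obtain ⟨s, hs, hs2⟩ : ∃ s : ℝ, 0 < s ∧ s ^ 2 = 1 - A x ^ 2 :=
      ⟨_, Real.sqrt_pos.mpr hA0, Real.sq_sqrt hA0.le⟩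
    obtain ⟨t, ht, ht2⟩ : ∃ t : ℝ, 0 < t ∧ t ^ 2 = 1 - B x ^ 2 :=
      ⟨_, Real.sqrt_pos.mpr hB0, Real.sq_sqrt hB0.le⟩
    have hm : ∀ (c d : ℝ) (v w : E2), metric X x (c • v) (d • w) = c * d * metric X x v w := by
      intro c d v w
      simp only [metric, map_smul, ip_smul_left, ip_smul_right]; ring
    have hconf : IsConformalPair X x (s • v₁ x) (t • v₂ x) := by
      constructor
      · rw [hm, hm, h.metric_self, h.symm.metric_self, ← pow_two, ← pow_two, hs2, ht2]
        field_simp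
      · rw [hm, h.metric_orth, mul_zero]
    have hz := hhopf x x.2 _ _ hconf
    rw [hopf_smul (secondFF_eq_sffBilin hU hX x.2)] at hz
    have hre := congrArg Complex.re hz
    have him := congrArg Complex.im hz
    have hF : ∀ v w : E2, ip (prodStr (fderiv ℝ X x v)) (fderiv ℝ X x w) =
        qf 1 (fderiv ℝ X x v).1 (fderiv ℝ X x w).1 -
          qf (-1) (fderiv ℝ X x v).2 (fderiv ℝ X x w).2 := by
      intro v w
      have : -(fderiv ℝ X x v).2 = (-1 : ℝ) • (fderiv ℝ X x v).2 := by simp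
      rw [ip_eq, prodStr, this, qf_smul_left]
      ring
    have hAA : (1 - A x ^ 2) * ip (prodStr (fderiv ℝ X x (v₁ x))) (fderiv ℝ X x (v₁ x)) = A x := by
      obtain ⟨p1, p2⟩ := h.pos
      rw [hF, h.fst_eq, h.snd_eq]
      field_simp
      ring
    have hBB : (1 - B x ^ 2) * ip (prodStr (fderiv ℝ X x (v₂ x))) (fderiv ℝ X x (v₂ x)) = B x := by
      obtain ⟨p1, p2⟩ := h.symm.pos
      rw [hF, h.symm.fst_eq, h.symm.snd_eq]
      field_simp
      ring
    simp only [← secondFF_eq_sffBilin hU hX x.2, hs2, ht2, hAA, hBB, Complex.zero_re] at hre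
    simp only [← secondFF_eq_sffBilin hU hX x.2, hF, h.fst_orth, h.snd_orth, h.symm.fst_orth,
      h.symm.snd_orth, Complex.zero_im, sub_zero, add_zero, zero_div, neg_mul, neg_eq_zero] at him
    exact ⟨hre, (mul_eq_zero.mp him).resolve_left (mul_pos hs ht).ne'⟩
  have ipH : ∀ (x : U) (c d : ℝ),
      ip (c • nuVec (A x) (fderiv ℝ X x (v₁ x)) + d • nuVec (B x) (fderiv ℝ X x (v₂ x)))
        (meanCurv X x) =
      evalAt x (meanOne (coordFst hX) (coordSnd hX) (toRing A hA) (toRing B hB) (vecDeriv hU h₁)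
        (vecDeriv hU h₂)) * c -
      evalAt x (meanTwo (coordFst hX) (coordSnd hX) (toRing A hA) (toRing B hB) (vecDeriv hU h₁)
        (vecDeriv hU h₂)) * d := by
    intro x c d
    have h := hfr x x.2
    rw [meanCurv_frame hU hX h₁ h₂ hA hB hfr x]
    simp only [ip_add_left, ip_sub_right, ip_smul_left, ip_smul_right, h.ip_nuVec_self,
      h.symm.ip_nuVec_self, h.ip_nuVec_nuVec, h.symm.ip_nuVec_nuVec]
    ring
  constructor
  · refine ext_evalAt fun x => ?_
    have := (key x).1
    rw [secondFF_frame hU hX h₁ h₂ hA hB hfr h₁ h₁, secondFF_frame hU hX h₁ h₂ hA hB hfr h₂ h₂,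
      ipH, ipH] at this
    simp only [map_add, map_sub, map_mul, map_pow, map_one, map_ofNat, map_zero, evalAt_toRing]
    linear_combination 4 * this
  · refine ext_evalAt fun x => ?_
    have := (key x).2
    rw [secondFF_frame hU hX h₁ h₂ hA hB hfr h₁ h₂, secondFF_frame hU hX h₁ h₂ hA hB hfr h₂ h₁,
      ipH, ipH] at this
    simp only [map_add, map_sub, map_mul, map_zero]
    linear_combination this

end

theorem adaptedFrame_false {U : Set E2} {X : E2 → V} {v₁ v₂ : E2 → E2} {A B : E2 → ℝ}
    (hU : IsOpen U) (hX : ContDiffOn ℝ ∞ X U)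
    (h₁ : ContDiffOn ℝ ∞ v₁ U) (h₂ : ContDiffOn ℝ ∞ v₂ U) (hA : ContDiffOn ℝ ∞ A U)
    (hB : ContDiffOn ℝ ∞ B U)
    (hfr : ∀ x ∈ U, IsAdaptedFrame X x (v₁ x) (v₂ x) (A x) (B x))
    (hpar : ∀ x ∈ U, ∀ v, normalDerivMeanCurv X x v = 0)
    (hne : ∀ x ∈ U, meanCurv X x ≠ 0)
    (hhopf : ∀ x ∈ U, ∀ v w, IsConformalPair X x v w → hopf X x v w = 0)
    (hAB : (∀ x ∈ U, A x ≠ B x) ∨ ∀ x ∈ U, A x = B x) {x₀ : E2} (hx₀ : x₀ ∈ U) : False := by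
  have hP := isParallelFrame hU hX h₁ h₂ hA hB hfr hpar
  rcases hAB with hAB | hAB
  · exact hP.false (hopfFrame hU hX h₁ h₂ hA hB hfr hhopf) (fun x => hAB x x.2) ⟨x₀, hx₀⟩
  · obtain ⟨h1, h2⟩ := hP.eq_zero_of_eq (ext_evalAt fun x => hAB x x.2)
    refine hne x₀ hx₀ ?_
    have := meanCurv_frame hU hX h₁ h₂ hA hB hfr ⟨x₀, hx₀⟩
    rw [h1, h2] at this
    simpa using this

/-! ### Simultaneous diagonalization of two smooth families of positive definite forms -/

/-- The symmetric bilinear form on `ℝ²` with matrix `(m₀, m₁; m₁, m₂)`. -/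
def bil (m₀ m₁ m₂ s t s' t' : ℝ) : ℝ := m₀ * s * s' + m₁ * (s * t' + t * s') + m₂ * t * t'

theorem bil_pos {m₀ m₁ m₂ s t : ℝ} (h0 : 0 < m₀) (hdet : 0 < m₀ * m₂ - m₁ ^ 2)
    (hst : s ≠ 0 ∨ t ≠ 0) : 0 < bil m₀ m₁ m₂ s t s t := by
  have key : m₀ * bil m₀ m₁ m₂ s t s t = (m₀ * s + m₁ * t) ^ 2 + (m₀ * m₂ - m₁ ^ 2) * t ^ 2 := by
    unfold bil; ring
  have : 0 < m₀ * bil m₀ m₁ m₂ s t s t := by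
    rw [key]
    by_cases ht : t = 0
    · have hs : s ≠ 0 := hst.resolve_right (not_not.mpr ht)
      subst ht
      have := h0.ne'
      have : 0 < (m₀ * s) ^ 2 := by positivity
      simpa using this
    · have : 0 < (m₀ * m₂ - m₁ ^ 2) * t ^ 2 := by positivity
      positivity
  exact (mul_pos_iff_of_pos_left h0).mp this

/-- The discriminant times `q₀ ^ 2` is a square plus a positive multiple of the square of the first
minor. If it is not positive, all three minors vanish. -/
theorem proportional_of_discr {p₀ p₁ p₂ q₀ q₁ q₂ : ℝ} (hq0 : 0 < q₀) (hq : 0 < q₀ * q₂ - q₁ ^ 2)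
    (h : (p₀ * q₂ - p₂ * q₀) ^ 2 - 4 * (p₀ * q₁ - p₁ * q₀) * (p₁ * q₂ - p₂ * q₁) ≤ 0) :
    p₀ * q₁ - p₁ * q₀ = 0 ∧ p₀ * q₂ - p₂ * q₀ = 0 ∧ p₁ * q₂ - p₂ * q₁ = 0 := by
  have key : q₀ ^ 2 * ((p₀ * q₂ - p₂ * q₀) ^ 2 -
      4 * (p₀ * q₁ - p₁ * q₀) * (p₁ * q₂ - p₂ * q₁)) =
      (q₀ * (p₀ * q₂ - p₂ * q₀) - 2 * q₁ * (p₀ * q₁ - p₁ * q₀)) ^ 2 +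
        4 * (q₀ * q₂ - q₁ ^ 2) * (p₀ * q₁ - p₁ * q₀) ^ 2 := by ring
  have hle := mul_nonpos_of_nonneg_of_nonpos (sq_nonneg q₀) h
  rw [key] at hle
  have h1 : (p₀ * q₁ - p₁ * q₀) ^ 2 = 0 := by
    have := sq_nonneg (q₀ * (p₀ * q₂ - p₂ * q₀) - 2 * q₁ * (p₀ * q₁ - p₁ * q₀))
    have h2 : (q₀ * q₂ - q₁ ^ 2) * (p₀ * q₁ - p₁ * q₀) ^ 2 ≤ 0 := by linarith
    nlinarith [sq_nonneg (p₀ * q₁ - p₁ * q₀)]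
  have ha : p₀ * q₁ - p₁ * q₀ = 0 := pow_eq_zero_iff (two_ne_zero) |>.mp h1
  have hb : p₀ * q₂ - p₂ * q₀ = 0 := by
    rw [ha] at hle
    have : (q₀ * (p₀ * q₂ - p₂ * q₀)) ^ 2 = 0 := le_antisymm (by linarith) (sq_nonneg _)
    exact (mul_eq_zero.mp (pow_eq_zero_iff (two_ne_zero) |>.mp this)).resolve_left hq0.ne'
  refine ⟨ha, hb, ?_⟩
  have : q₀ * (p₁ * q₂ - p₂ * q₁) = 0 := by linear_combination q₁ * hb - q₂ * ha
  exact (mul_eq_zero.mp this).resolve_left hq0.ne'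

/-- In a basis orthogonal for both forms with equal ratios of the diagonal values, `Q p = P q`.
Undoing the change of basis gives this for each coefficient. -/
theorem proportional_of_frame {p₀ p₁ p₂ q₀ q₁ q₂ s t s' t' : ℝ} (hdet : s * t' - t * s' ≠ 0)
    (hp : bil p₀ p₁ p₂ s t s' t' = 0) (hq : bil q₀ q₁ q₂ s t s' t' = 0)
    (hq1 : bil q₀ q₁ q₂ s t s t ≠ 0)
    (h : bil p₀ p₁ p₂ s t s t * bil q₀ q₁ q₂ s' t' s' t' =
      bil p₀ p₁ p₂ s' t' s' t' * bil q₀ q₁ q₂ s t s t) :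
    p₀ * q₁ - p₁ * q₀ = 0 ∧ p₀ * q₂ - p₂ * q₀ = 0 := by
  set P := bil p₀ p₁ p₂ s t s t with hP
  set Q := bil q₀ q₁ q₂ s t s t with hQ
  have h0 : Q * p₀ = P * q₀ := by
    have : (s * t' - t * s') ^ 2 * (Q * p₀ - P * q₀) = 0 := by
      have e : ∀ a b c : ℝ, (s * t' - t * s') ^ 2 * a = t' ^ 2 * bil a b c s t s t -
          2 * t * t' * bil a b c s t s' t' + t ^ 2 * bil a b c s' t' s' t' := by
        intro a b c; unfold bil; ring
      rw [mul_sub, mul_left_comm, mul_left_comm _ P, e p₀ p₁ p₂, e q₀ q₁ q₂, hp, hq, ← hP, ← hQ]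
      linear_combination -t ^ 2 * h
    linarith [(mul_eq_zero.mp this).resolve_left (pow_ne_zero 2 hdet)]
  have h1 : Q * p₁ = P * q₁ := by
    have : (s * t' - t * s') ^ 2 * (Q * p₁ - P * q₁) = 0 := by
      have e : ∀ a b c : ℝ, (s * t' - t * s') ^ 2 * b = -(s' * t') * bil a b c s t s t +
          (s * t' + t * s') * bil a b c s t s' t' - s * t * bil a b c s' t' s' t' := by
        intro a b c; unfold bil; ring
      rw [mul_sub, mul_left_comm, mul_left_comm _ P, e p₀ p₁ p₂, e q₀ q₁ q₂, hp, hq, ← hP, ← hQ]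
      linear_combination s * t * h
    linarith [(mul_eq_zero.mp this).resolve_left (pow_ne_zero 2 hdet)]
  have h2 : Q * p₂ = P * q₂ := by
    have : (s * t' - t * s') ^ 2 * (Q * p₂ - P * q₂) = 0 := by
      have e : ∀ a b c : ℝ, (s * t' - t * s') ^ 2 * c = s' ^ 2 * bil a b c s t s t -
          2 * s * s' * bil a b c s t s' t' + s ^ 2 * bil a b c s' t' s' t' := by
        intro a b c; unfold bil; ring
      rw [mul_sub, mul_left_comm, mul_left_comm _ P, e p₀ p₁ p₂, e q₀ q₁ q₂, hp, hq, ← hP, ← hQ]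
      linear_combination -s ^ 2 * h
    linarith [(mul_eq_zero.mp this).resolve_left (pow_ne_zero 2 hdet)]
  constructor
  · have : Q * (p₀ * q₁ - p₁ * q₀) = 0 := by linear_combination q₁ * h0 - q₀ * h1
    exact (mul_eq_zero.mp this).resolve_left hq1
  · have : Q * (p₀ * q₂ - p₂ * q₀) = 0 := by linear_combination q₂ * h0 - q₀ * h2
    exact (mul_eq_zero.mp this).resolve_left hq1

/-- The common orthogonal directions are the zeros of `a s² + b s t + c t²`, the Jacobian of the two
forms up to a factor. They depend smoothly on the point where the discriminant `d` is positive; if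
`d ≤ 0` throughout, the forms are proportional and any `q`-orthogonal frame serves. It suffices to
shrink to some nonempty open set, so points where the eigenvalues cross may be avoided. -/
theorem exists_diagonal {U : Set E2} (hU : IsOpen U) (hne : U.Nonempty)
    {p₀ p₁ p₂ q₀ q₁ q₂ : E2 → ℝ} (hp₀ : ContDiffOn ℝ ∞ p₀ U) (hp₁ : ContDiffOn ℝ ∞ p₁ U)
    (hp₂ : ContDiffOn ℝ ∞ p₂ U) (hq₀ : ContDiffOn ℝ ∞ q₀ U) (hq₁ : ContDiffOn ℝ ∞ q₁ U)
    (hq₂ : ContDiffOn ℝ ∞ q₂ U)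
    (hq : ∀ x ∈ U, 0 < q₀ x ∧ 0 < q₀ x * q₂ x - q₁ x ^ 2) :
    ∃ W ⊆ U, IsOpen W ∧ W.Nonempty ∧ ∃ s t s' t' : E2 → ℝ, ContDiffOn ℝ ∞ s W ∧
      ContDiffOn ℝ ∞ t W ∧ ContDiffOn ℝ ∞ s' W ∧ ContDiffOn ℝ ∞ t' W ∧
      (∀ x ∈ W, s x * t' x - t x * s' x ≠ 0 ∧
        bil (p₀ x) (p₁ x) (p₂ x) (s x) (t x) (s' x) (t' x) = 0 ∧
        bil (q₀ x) (q₁ x) (q₂ x) (s x) (t x) (s' x) (t' x) = 0) ∧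
      ((∀ x ∈ W, bil (p₀ x) (p₁ x) (p₂ x) (s x) (t x) (s x) (t x) *
          bil (q₀ x) (q₁ x) (q₂ x) (s' x) (t' x) (s' x) (t' x) ≠
        bil (p₀ x) (p₁ x) (p₂ x) (s' x) (t' x) (s' x) (t' x) *
          bil (q₀ x) (q₁ x) (q₂ x) (s x) (t x) (s x) (t x)) ∨
      ∀ x ∈ W, bil (p₀ x) (p₁ x) (p₂ x) (s x) (t x) (s x) (t x) *
          bil (q₀ x) (q₁ x) (q₂ x) (s' x) (t' x) (s' x) (t' x) =
        bil (p₀ x) (p₁ x) (p₂ x) (s' x) (t' x) (s' x) (t' x) *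
          bil (q₀ x) (q₁ x) (q₂ x) (s x) (t x) (s x) (t x)) := by
  set a : E2 → ℝ := fun x => p₀ x * q₁ x - p₁ x * q₀ x with ha
  set b : E2 → ℝ := fun x => p₀ x * q₂ x - p₂ x * q₀ x with hb
  set c : E2 → ℝ := fun x => p₁ x * q₂ x - p₂ x * q₁ x with hc
  set d : E2 → ℝ := fun x => b x ^ 2 - 4 * a x * c x with hd
  have sa : ContDiffOn ℝ ∞ a U := (hp₀.mul hq₁).sub (hp₁.mul hq₀)
  have sb : ContDiffOn ℝ ∞ b U := (hp₀.mul hq₂).sub (hp₂.mul hq₀)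
  have sc : ContDiffOn ℝ ∞ c U := (hp₁.mul hq₂).sub (hp₂.mul hq₁)
  have sd : ContDiffOn ℝ ∞ d U := (sb.pow 2).sub ((contDiffOn_const.mul sa).mul sc)
  by_cases hcase : ∃ x₁ ∈ U, 0 < d x₁
  · obtain ⟨x₁, hx₁, hdx⟩ := hcase
    -- The sign of the root is that of `b x₁`, so that `b + δ` cannot vanish at `x₁` by
    -- cancellation.
    obtain ⟨ε, hε, hbε⟩ : ∃ ε : ℝ, ε ^ 2 = 1 ∧ 0 ≤ ε * b x₁ := by
      rcases le_total 0 (b x₁) with h | h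
      · exact ⟨1, by norm_num, by linarith⟩
      · exact ⟨-1, by norm_num, by linarith⟩
    set W₁ : Set E2 := U ∩ d ⁻¹' Set.Ioi 0 with hW₁
    have oW₁ : IsOpen W₁ := sd.continuousOn.isOpen_inter_preimage hU isOpen_Ioi
    set δ : E2 → ℝ := fun x => ε * Real.sqrt (d x) with hδ
    have sδ : ContDiffOn ℝ ∞ δ W₁ := contDiffOn_const.mul
      ((sd.mono Set.inter_subset_left).sqrt fun x hx => (Set.mem_Ioi.mp hx.2).ne')
    have hδ2 : ∀ x ∈ W₁, δ x ^ 2 = b x ^ 2 - 4 * a x * c x := by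
      intro x hx
      rw [hδ, mul_pow, hε, one_mul, Real.sq_sqrt (le_of_lt hx.2)]
    have sbδ : ContDiffOn ℝ ∞ (fun x => b x + δ x) W₁ := (sb.mono Set.inter_subset_left).add sδ
    set W : Set E2 := W₁ ∩ (fun x => b x + δ x) ⁻¹' {0}ᶜ with hW
    have oW : IsOpen W := sbδ.continuousOn.isOpen_inter_preimage oW₁ isOpen_compl_singleton
    have hWU : W ⊆ U := fun x hx => hx.1.1
    have hδne : ∀ x ∈ W, δ x ≠ 0 := by
      intro x hx h0
      have := hδ2 x hx.1
      have h1 : 0 < d x := hx.1.2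
      rw [h0] at this
      simp only [hd] at h1
      linarith
    -- The two zeros of the Jacobian in the forms `(b + δ, -2 a)` and `(-2 c, b + δ)`; their
    -- determinant is `2 δ (b + δ)`.
    refine ⟨W, hWU, oW, ⟨x₁, ⟨hx₁, hdx⟩, ?_⟩, fun x => b x + δ x, fun x => -2 * a x,
      fun x => -2 * c x, fun x => b x + δ x, sbδ.mono Set.inter_subset_left,
      contDiffOn_const.mul (sa.mono hWU), contDiffOn_const.mul (sc.mono hWU),
      sbδ.mono Set.inter_subset_left, ?_, Or.inl ?_⟩
    · intro h0
      have h1 : b x₁ + ε * Real.sqrt (d x₁) = 0 := h0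
      have h2 : ε * b x₁ + Real.sqrt (d x₁) = 0 := by
        linear_combination ε * h1 - Real.sqrt (d x₁) * hε
      have := Real.sqrt_pos.mpr hdx
      linarith
    all_goals
      have hframe : ∀ x ∈ W, (b x + δ x) * (b x + δ x) - (-2 * a x) * (-2 * c x) ≠ 0 ∧
          bil (p₀ x) (p₁ x) (p₂ x) (b x + δ x) (-2 * a x) (-2 * c x) (b x + δ x) = 0 ∧
          bil (q₀ x) (q₁ x) (q₂ x) (b x + δ x) (-2 * a x) (-2 * c x) (b x + δ x) = 0 := by
        intro x hx
        have h2 := hδ2 x hx.1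
        have h3 : b x + δ x ≠ 0 := hx.2
        refine ⟨?_, ?_, ?_⟩
        · have : (b x + δ x) * (b x + δ x) - (-2 * a x) * (-2 * c x) =
              2 * (δ x * (b x + δ x)) := by linear_combination -h2
          rw [this]
          exact mul_ne_zero two_ne_zero (mul_ne_zero (hδne x hx) h3)
        · have e : p₁ x * b x - p₀ x * c x - p₂ x * a x = 0 := by
            simp only [ha, hb, hc]; ring
          unfold bil
          linear_combination 2 * (b x + δ x) * e + p₁ x * h2
        · have e : q₁ x * b x - q₀ x * c x - q₂ x * a x = 0 := by
            simp only [ha, hb, hc]; ring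
          unfold bil
          linear_combination 2 * (b x + δ x) * e + q₁ x * h2
    · exact hframe
    · intro x hx heq
      obtain ⟨f1, f2, f3⟩ := hframe x hx
      obtain ⟨hq0, hqd⟩ := hq x (hWU hx)
      have hQ := bil_pos (s := b x + δ x) (t := -2 * a x) hq0 hqd (Or.inl hx.2)
      obtain ⟨g1, g2⟩ := proportional_of_frame f1 f2 f3 hQ.ne' heq
      have h1 : 0 < d x := hx.1.2
      have g1' : a x = 0 := g1
      have g2' : b x = 0 := g2
      simp only [hd, g1', g2'] at h1
      norm_num at h1
  · push Not at hcase
    -- The Gram–Schmidt frame of `q` without normalization.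
    refine ⟨U, subset_rfl, hU, hne, fun _ => 1, fun _ => 0, fun x => -q₁ x, q₀, contDiffOn_const,
      contDiffOn_const, hq₁.neg, hq₀, ?_, Or.inr ?_⟩
    all_goals
      intro x hx
      obtain ⟨hq0, hqd⟩ := hq x hx
      obtain ⟨e1, e2, e3⟩ := proportional_of_discr (p₀ := p₀ x) (p₁ := p₁ x) (p₂ := p₂ x) hq0 hqd
        (hcase x hx)
    · refine ⟨by simpa using hq0.ne', ?_, ?_⟩
      · unfold bil; linear_combination -e1
      · unfold bil; ring
    · unfold bil
      linear_combination q₀ x * q₀ x * e2 - 2 * q₁ x * q₀ x * e1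

/-! ### Surfaces without tangent vectors to the factors -/

theorem contDiffOn_qf {U : Set E2} (σ : ℝ) {f g : E2 → Fin 3 → ℝ} (hf : ContDiffOn ℝ ∞ f U)
    (hg : ContDiffOn ℝ ∞ g U) : ContDiffOn ℝ ∞ (fun x => qf σ (f x) (g x)) U := by
  have f1 := contDiffOn_pi.mp hf
  have g1 := contDiffOn_pi.mp hg
  simp only [qf, smul_eq_mul]
  exact (((f1 0).mul (g1 0)).add ((f1 1).mul (g1 1))).add
    (contDiffOn_const.mul ((f1 2).mul (g1 2)))

theorem qf_one_pos {u : Fin 3 → ℝ} (hu : u ≠ 0) : 0 < qf 1 u u := by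
  rw [qf_one]
  exact lt_of_le_of_ne (by
    simp only [dotProduct, Fin.sum_univ_three]
    nlinarith [mul_self_nonneg (u 0), mul_self_nonneg (u 1), mul_self_nonneg (u 2)])
    (fun h => hu (dotProduct_self_eq_zero.mp h.symm))

/-- The tangent planes of the hyperboloid are spacelike. -/
theorem qf_neg_one_pos {b w : Fin 3 → ℝ} (hb : b ∈ hyp) (hw : qf (-1) b w = 0) (hw0 : w ≠ 0) :
    0 < qf (-1) w w := by
  obtain ⟨hb1, hb2⟩ := hb
  rw [qf_neg_one] at hw ⊢
  simp only [mink] at hb1 hw ⊢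
  by_contra! hle
  -- Eliminating `w 2` by the tangency condition and using `b 2 ^ 2 = 1 + b 0 ^ 2 + b 1 ^ 2` leaves
  -- a sum of squares.
  have h1 : b 2 ^ 2 * (w 0 * w 0 + w 1 * w 1 - w 2 * w 2) =
      w 0 ^ 2 + w 1 ^ 2 + (b 0 * w 1 - b 1 * w 0) ^ 2 := by
    have h2 : b 2 * w 2 = b 0 * w 0 + b 1 * w 1 := by linarith
    have h3 : b 2 ^ 2 = 1 + b 0 ^ 2 + b 1 ^ 2 := by linarith
    linear_combination (w 0 ^ 2 + w 1 ^ 2) * h3 -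
      (b 2 * w 2 + (b 0 * w 0 + b 1 * w 1)) * h2
  have h4 := mul_nonpos_of_nonneg_of_nonpos (sq_nonneg (b 2)) hle
  rw [h1] at h4
  have hw00 : w 0 = 0 := by
    have : w 0 ^ 2 = 0 := by
      nlinarith [sq_nonneg (w 0), sq_nonneg (w 1), sq_nonneg (b 0 * w 1 - b 1 * w 0)]
    exact pow_eq_zero_iff two_ne_zero |>.mp this
  have hw11 : w 1 = 0 := by
    have : w 1 ^ 2 = 0 := by
      nlinarith [sq_nonneg (w 0), sq_nonneg (w 1), sq_nonneg (b 0 * w 1 - b 1 * w 0)]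
    exact pow_eq_zero_iff two_ne_zero |>.mp this
  have hw22 : w 2 = 0 := by
    rw [hw00, hw11] at hw
    have : b 2 * w 2 = 0 := by linarith
    exact (mul_eq_zero.mp this).resolve_left hb2.ne'
  exact hw0 (by ext k; fin_cases k <;> simp [hw00, hw11, hw22])

theorem det_pos_of_pos {m₀ m₁ m₂ : ℝ}
    (h : ∀ s t : ℝ, (s ≠ 0 ∨ t ≠ 0) → 0 < bil m₀ m₁ m₂ s t s t) :
    0 < m₀ ∧ 0 < m₀ * m₂ - m₁ ^ 2 := by
  have h0 : 0 < m₀ := by simpa [bil] using h 1 0 (Or.inl one_ne_zero)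
  refine ⟨h0, ?_⟩
  have h1 := h (-m₁) m₀ (Or.inr h0.ne')
  have h2 : bil m₀ m₁ m₂ (-m₁) m₀ (-m₁) m₀ = m₀ * (m₀ * m₂ - m₁ ^ 2) := by unfold bil; ring
  rw [h2] at h1
  exact (mul_pos_iff_of_pos_left h0).mp h1

section

variable {U : Set E2} {X : E2 → V}

theorem tangent_fst (hU : IsOpen U) (hX : ContDiffOn ℝ ∞ X U) (h : ∀ x ∈ U, (X x).1 ∈ sphere)
    {x : E2} (hx : x ∈ U) (w : E2) : qf 1 (X x).1 (fderiv ℝ X x w).1 = 0 := by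
  have h1 : qf 1 (coordFst hX) (coordFst hX) = algebraMap ℝ (smoothRing U) 1 :=
    ext_evalAt fun y => by
      rw [map_qf, evalAt_coordFst, AlgHom.commutes, qf_one]
      exact h y y.2
  have h2 := congrArg (fun f => evalAt ⟨x, hx⟩
    (vecDeriv hU (v := fun _ => w) contDiffOn_const f)) h1
  simp only [derivation_qf, Derivation.map_algebraMap, map_zero, map_add, map_qf,
    evalAt_dvec_coordFst, evalAt_coordFst] at h2
  rw [qf_comm 1 (fderiv ℝ X x w).1] at h2
  linarith

theorem tangent_snd (hU : IsOpen U) (hX : ContDiffOn ℝ ∞ X U) (h : ∀ x ∈ U, (X x).2 ∈ hyp)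
    {x : E2} (hx : x ∈ U) (w : E2) : qf (-1) (X x).2 (fderiv ℝ X x w).2 = 0 := by
  have h1 : qf (-1) (coordSnd hX) (coordSnd hX) = algebraMap ℝ (smoothRing U) (-1) :=
    ext_evalAt fun y => by
      rw [map_qf, evalAt_coordSnd, AlgHom.commutes, qf_neg_one]
      exact (h y y.2).1
  have h2 := congrArg (fun f => evalAt ⟨x, hx⟩
    (vecDeriv hU (v := fun _ => w) contDiffOn_const f)) h1
  simp only [derivation_qf, Derivation.map_algebraMap, map_zero, map_add, map_qf,
    evalAt_dvec_coordSnd, evalAt_coordSnd] at h2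
  rw [qf_comm (-1) (fderiv ℝ X x w).2] at h2
  linarith

/-- The vector of `ℝ²` with coordinates `s, t`. -/
def vec (s t : ℝ) : E2 := s • basisVec 0 + t • basisVec 1

theorem qf_fst_vec (x : E2) (s t s' t' : ℝ) :
    qf 1 (fderiv ℝ X x (vec s t)).1 (fderiv ℝ X x (vec s' t')).1 =
      bil (qf 1 (fderiv ℝ X x (basisVec 0)).1 (fderiv ℝ X x (basisVec 0)).1)
        (qf 1 (fderiv ℝ X x (basisVec 0)).1 (fderiv ℝ X x (basisVec 1)).1)
        (qf 1 (fderiv ℝ X x (basisVec 1)).1 (fderiv ℝ X x (basisVec 1)).1) s t s' t' := by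
  simp only [vec, map_add, map_smul, Prod.fst_add, Prod.smul_fst, qf_add_left, qf_add_right,
    qf_smul_left, qf_smul_right, bil, qf_comm 1 (fderiv ℝ X x (basisVec 1)).1
      (fderiv ℝ X x (basisVec 0)).1]
  ring

theorem qf_snd_vec (x : E2) (s t s' t' : ℝ) :
    qf (-1) (fderiv ℝ X x (vec s t)).2 (fderiv ℝ X x (vec s' t')).2 =
      bil (qf (-1) (fderiv ℝ X x (basisVec 0)).2 (fderiv ℝ X x (basisVec 0)).2)
        (qf (-1) (fderiv ℝ X x (basisVec 0)).2 (fderiv ℝ X x (basisVec 1)).2)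
        (qf (-1) (fderiv ℝ X x (basisVec 1)).2 (fderiv ℝ X x (basisVec 1)).2) s t s' t' := by
  simp only [vec, map_add, map_smul, Prod.snd_add, Prod.smul_snd, qf_add_left, qf_add_right,
    qf_smul_left, qf_smul_right, bil, qf_comm (-1) (fderiv ℝ X x (basisVec 1)).2
      (fderiv ℝ X x (basisVec 0)).2]
  ring

theorem vec_ne_zero {s t : ℝ} (h : s ≠ 0 ∨ t ≠ 0) : vec s t ≠ 0 := by
  intro h0
  have h1 := congrArg (fun u : E2 => u 0) h0
  have h2 := congrArg (fun u : E2 => u 1) h0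
  simp [vec, basisVec] at h1 h2
  rcases h with h | h
  · exact h h1
  · exact h h2

/-- Here `P₁, Q₁` are the squared lengths of a vector in the two factors. The eigenvalue of `F` is
`A = (P₁ - Q₁) / (P₁ + Q₁)`, and the scale `r` is fixed by `r ^ 2 * P₁ = 1 / (2 * (1 - A))`, which
is `r ^ 2 = (P₁ + Q₁) / (4 * P₁ * Q₁)`. -/
theorem adapted_of_orthogonal {P₁ Q₁ : ℝ} (hP₁ : 0 < P₁) (hQ₁ : 0 < Q₁) :
    ((P₁ - Q₁) / (P₁ + Q₁)) ^ 2 < 1 ∧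
    2 * (1 - (P₁ - Q₁) / (P₁ + Q₁)) *
      (Real.sqrt ((P₁ + Q₁) / (4 * P₁ * Q₁)) * (Real.sqrt ((P₁ + Q₁) / (4 * P₁ * Q₁)) * P₁)) = 1 ∧
    2 * (1 + (P₁ - Q₁) / (P₁ + Q₁)) *
      (Real.sqrt ((P₁ + Q₁) / (4 * P₁ * Q₁)) * (Real.sqrt ((P₁ + Q₁) / (4 * P₁ * Q₁)) * Q₁)) =
        1 := by
  have hs : 0 < P₁ + Q₁ := add_pos hP₁ hQ₁
  have h1 : Real.sqrt ((P₁ + Q₁) / (4 * P₁ * Q₁)) * Real.sqrt ((P₁ + Q₁) / (4 * P₁ * Q₁)) =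
      (P₁ + Q₁) / (4 * P₁ * Q₁) := Real.mul_self_sqrt (by positivity)
  refine ⟨?_, ?_, ?_⟩
  · rw [div_pow, div_lt_one (by positivity)]
    nlinarith [mul_pos hP₁ hQ₁]
  · rw [← mul_assoc (Real.sqrt _), h1]
    field_simp
    ring
  · rw [← mul_assoc (Real.sqrt _), h1]
    field_simp
    ring

/-- A parametrized surface with parallel mean curvature vector and vanishing Hopf differential
has at each point a tangent direction that is tangent to one of the factors. -/
theorem exists_tangent_factor (hU : IsOpen U) (hX : ContDiffOn ℝ ∞ X U)
    (hS : ∀ x ∈ U, (X x).1 ∈ sphere) (hH : ∀ x ∈ U, (X x).2 ∈ hyp)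
    (hpar : ∀ x ∈ U, ∀ v, normalDerivMeanCurv X x v = 0) (hne : ∀ x ∈ U, meanCurv X x ≠ 0)
    (hhopf : ∀ x ∈ U, ∀ v w, IsConformalPair X x v w → hopf X x v w = 0) {x₀ : E2}
    (hx₀ : x₀ ∈ U) :
    ∃ w : E2, w ≠ 0 ∧ ((fderiv ℝ X x₀ w).1 = 0 ∨ (fderiv ℝ X x₀ w).2 = 0) := by
  by_contra! hc
  have tf := fun {x : E2} (hx : x ∈ U) => tangent_fst hU hX hS hx
  have ts := fun {x : E2} (hx : x ∈ U) => tangent_snd hU hX hH hx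
  set E : Fin 2 → E2 → V := fun i x => fderiv ℝ X x (basisVec i) with hE
  have sE : ∀ i, ContDiffOn ℝ ∞ (E i) U := fun i => contDiffOn_fderiv_apply hU hX contDiffOn_const
  set p : Fin 2 → Fin 2 → E2 → ℝ := fun i j x => qf 1 (E i x).1 (E j x).1 with hp
  set q : Fin 2 → Fin 2 → E2 → ℝ := fun i j x => qf (-1) (E i x).2 (E j x).2 with hq
  have sp : ∀ i j, ContDiffOn ℝ ∞ (p i j) U := fun i j =>
    contDiffOn_qf 1 (contDiff_fst.comp_contDiffOn (sE i)) (contDiff_fst.comp_contDiffOn (sE j))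
  have sq : ∀ i j, ContDiffOn ℝ ∞ (q i j) U := fun i j =>
    contDiffOn_qf (-1) (contDiff_snd.comp_contDiffOn (sE i)) (contDiff_snd.comp_contDiffOn (sE j))
  have sdp : ContDiffOn ℝ ∞ (fun x => p 0 0 x * p 1 1 x - p 0 1 x ^ 2) U :=
    ((sp 0 0).mul (sp 1 1)).sub ((sp 0 1).pow 2)
  have sdq : ContDiffOn ℝ ∞ (fun x => q 0 0 x * q 1 1 x - q 0 1 x ^ 2) U :=
    ((sq 0 0).mul (sq 1 1)).sub ((sq 0 1).pow 2)
  obtain ⟨p1, p2⟩ : 0 < p 0 0 x₀ ∧ 0 < p 0 0 x₀ * p 1 1 x₀ - p 0 1 x₀ ^ 2 :=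
    det_pos_of_pos fun s t hst => by
      rw [← qf_fst_vec]
      exact qf_one_pos (hc _ (vec_ne_zero hst)).1
  obtain ⟨q1, q2⟩ : 0 < q 0 0 x₀ ∧ 0 < q 0 0 x₀ * q 1 1 x₀ - q 0 1 x₀ ^ 2 :=
    det_pos_of_pos fun s t hst => by
      rw [← qf_snd_vec]
      exact qf_neg_one_pos (hH x₀ hx₀) (ts hx₀ _) (hc _ (vec_ne_zero hst)).2
  -- The open set on which both pulled-back metrics are positive definite; it contains `x₀`.
  set U' : Set E2 := (U ∩ p 0 0 ⁻¹' Set.Ioi 0) ∩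
    (U ∩ (fun x => p 0 0 x * p 1 1 x - p 0 1 x ^ 2) ⁻¹' Set.Ioi 0) ∩
    ((U ∩ q 0 0 ⁻¹' Set.Ioi 0) ∩
    (U ∩ (fun x => q 0 0 x * q 1 1 x - q 0 1 x ^ 2) ⁻¹' Set.Ioi 0)) with hU'
  have oU' : IsOpen U' :=
    (((sp 0 0).continuousOn.isOpen_inter_preimage hU isOpen_Ioi).inter
      (sdp.continuousOn.isOpen_inter_preimage hU isOpen_Ioi)).inter
    (((sq 0 0).continuousOn.isOpen_inter_preimage hU isOpen_Ioi).inter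
      (sdq.continuousOn.isOpen_inter_preimage hU isOpen_Ioi))
  have hUU : U' ⊆ U := fun x hx => hx.1.1.1
  obtain ⟨W, hWU', oW, ⟨x₁, hx₁⟩, s, t, s', t', ss, st, ss', st', hfr, hAB⟩ :=
    exists_diagonal oU' ⟨x₀, ⟨⟨hx₀, p1⟩, hx₀, p2⟩, ⟨hx₀, q1⟩, hx₀, q2⟩
      ((sp 0 0).mono hUU) ((sp 0 1).mono hUU) ((sp 1 1).mono hUU)
      ((sq 0 0).mono hUU) ((sq 0 1).mono hUU) ((sq 1 1).mono hUU)
      (fun x hx => ⟨hx.2.1.2, hx.2.2.2⟩)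
  have hWU : W ⊆ U := hWU'.trans hUU
  set P₁ : E2 → ℝ := fun x => bil (p 0 0 x) (p 0 1 x) (p 1 1 x) (s x) (t x) (s x) (t x) with hP₁
  set P₂ : E2 → ℝ := fun x =>
    bil (p 0 0 x) (p 0 1 x) (p 1 1 x) (s' x) (t' x) (s' x) (t' x) with hP₂
  set Q₁ : E2 → ℝ := fun x => bil (q 0 0 x) (q 0 1 x) (q 1 1 x) (s x) (t x) (s x) (t x) with hQ₁
  set Q₂ : E2 → ℝ := fun x =>
    bil (q 0 0 x) (q 0 1 x) (q 1 1 x) (s' x) (t' x) (s' x) (t' x) with hQ₂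
  have sbil : ∀ {m₀ m₁ m₂ s t : E2 → ℝ}, ContDiffOn ℝ ∞ m₀ U → ContDiffOn ℝ ∞ m₁ U →
      ContDiffOn ℝ ∞ m₂ U → ContDiffOn ℝ ∞ s W → ContDiffOn ℝ ∞ t W →
      ContDiffOn ℝ ∞ (fun x => bil (m₀ x) (m₁ x) (m₂ x) (s x) (t x) (s x) (t x)) W := by
    intro m₀ m₁ m₂ s t h0 h1 h2 hs ht
    unfold bil
    exact ((((h0.mono hWU).mul hs).mul hs).add ((h1.mono hWU).mul ((hs.mul ht).add
      (ht.mul hs)))).add (((h2.mono hWU).mul ht).mul ht)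
  have sP₁ : ContDiffOn ℝ ∞ P₁ W := sbil (sp 0 0) (sp 0 1) (sp 1 1) ss st
  have sP₂ : ContDiffOn ℝ ∞ P₂ W := sbil (sp 0 0) (sp 0 1) (sp 1 1) ss' st'
  have sQ₁ : ContDiffOn ℝ ∞ Q₁ W := sbil (sq 0 0) (sq 0 1) (sq 1 1) ss st
  have sQ₂ : ContDiffOn ℝ ∞ Q₂ W := sbil (sq 0 0) (sq 0 1) (sq 1 1) ss' st'
  have hst : ∀ x ∈ W, s x ≠ 0 ∨ t x ≠ 0 := by
    intro x hx
    by_contra! h0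
    exact (hfr x hx).1 (by rw [h0.1, h0.2]; ring)
  have hst' : ∀ x ∈ W, s' x ≠ 0 ∨ t' x ≠ 0 := by
    intro x hx
    by_contra! h0
    exact (hfr x hx).1 (by rw [h0.1, h0.2]; ring)
  have pP₁ : ∀ x ∈ W, 0 < P₁ x := fun x hx =>
    bil_pos (hWU' hx).1.1.2 (hWU' hx).1.2.2 (hst x hx)
  have pP₂ : ∀ x ∈ W, 0 < P₂ x := fun x hx =>
    bil_pos (hWU' hx).1.1.2 (hWU' hx).1.2.2 (hst' x hx)
  have pQ₁ : ∀ x ∈ W, 0 < Q₁ x := fun x hx =>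
    bil_pos (hWU' hx).2.1.2 (hWU' hx).2.2.2 (hst x hx)
  have pQ₂ : ∀ x ∈ W, 0 < Q₂ x := fun x hx =>
    bil_pos (hWU' hx).2.1.2 (hWU' hx).2.2.2 (hst' x hx)
  have sA : ∀ {P Q : E2 → ℝ}, ContDiffOn ℝ ∞ P W → ContDiffOn ℝ ∞ Q W → (∀ x ∈ W, 0 < P x) →
      (∀ x ∈ W, 0 < Q x) → ContDiffOn ℝ ∞ (fun x => (P x - Q x) / (P x + Q x)) W :=
    fun hP hQ pP pQ => (hP.sub hQ).div (hP.add hQ) fun x hx => (add_pos (pP x hx) (pQ x hx)).ne'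
  have sr : ∀ {P Q : E2 → ℝ}, ContDiffOn ℝ ∞ P W → ContDiffOn ℝ ∞ Q W → (∀ x ∈ W, 0 < P x) →
      (∀ x ∈ W, 0 < Q x) →
      ContDiffOn ℝ ∞ (fun x => Real.sqrt ((P x + Q x) / (4 * P x * Q x))) W := by
    intro P Q hP hQ pP pQ
    refine ((hP.add hQ).div ((contDiffOn_const.mul hP).mul hQ) fun x hx => ?_).sqrt fun x hx => ?_
    all_goals
      have := pP x hx
      have := pQ x hx
    · exact (by positivity : 4 * P x * Q x ≠ 0)
    · exact (by positivity : (P x + Q x) / (4 * P x * Q x) ≠ 0)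
  have svec : ∀ {r s t : E2 → ℝ}, ContDiffOn ℝ ∞ r W → ContDiffOn ℝ ∞ s W → ContDiffOn ℝ ∞ t W →
      ContDiffOn ℝ ∞ (fun x => r x • vec (s x) (t x)) W := fun hr hs ht =>
    hr.smul ((hs.smul contDiffOn_const).add (ht.smul contDiffOn_const))
  refine adaptedFrame_false oW (hX.mono hWU)
    (svec (sr sP₁ sQ₁ pP₁ pQ₁) ss st) (svec (sr sP₂ sQ₂ pP₂ pQ₂) ss' st')
    (sA sP₁ sQ₁ pP₁ pQ₁) (sA sP₂ sQ₂ pP₂ pQ₂) ?_ (fun x hx => hpar x (hWU hx))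
    (fun x hx => hne x (hWU hx)) (fun x hx => hhopf x (hWU hx)) ?_ hx₁
  · intro x hx
    obtain ⟨-, f1, f2⟩ := hfr x hx
    obtain ⟨a1, a2, a3⟩ := adapted_of_orthogonal (pP₁ x hx) (pQ₁ x hx)
    obtain ⟨b1, b2, b3⟩ := adapted_of_orthogonal (pP₂ x hx) (pQ₂ x hx)
    constructor
    · rw [qf_one]; exact hS x (hWU hx)
    · rw [qf_neg_one]; exact (hH x (hWU hx)).1
    · exact tf (hWU hx)
    · exact ts (hWU hx)
    · rw [map_smul, map_smul, Prod.smul_fst, Prod.smul_fst, qf_smul_left, qf_smul_right,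
        qf_fst_vec]
      erw [f1]; ring
    · rw [map_smul, map_smul, Prod.smul_snd, Prod.smul_snd, qf_smul_left, qf_smul_right,
        qf_snd_vec]
      erw [f2]; ring
    · rw [map_smul, Prod.smul_fst, qf_smul_left, qf_smul_right, qf_fst_vec]
      exact a2
    · rw [map_smul, Prod.smul_snd, qf_smul_left, qf_smul_right, qf_snd_vec]
      exact a3
    · rw [map_smul, Prod.smul_fst, qf_smul_left, qf_smul_right, qf_fst_vec]
      exact b2
    · rw [map_smul, Prod.smul_snd, qf_smul_left, qf_smul_right, qf_snd_vec]
      exact b3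
    · exact a1
    · exact b1
  -- The eigenvalues coincide exactly where the ratios of the two squared lengths do, so the
  -- dichotomy of `exists_diagonal` becomes the one for `A` and `B`.
  · have hiff : ∀ x ∈ W, (P₁ x - Q₁ x) / (P₁ x + Q₁ x) = (P₂ x - Q₂ x) / (P₂ x + Q₂ x) ↔
        P₁ x * Q₂ x = P₂ x * Q₁ x := by
      intro x hx
      rw [div_eq_div_iff (add_pos (pP₁ x hx) (pQ₁ x hx)).ne' (add_pos (pP₂ x hx) (pQ₂ x hx)).ne']
      exact ⟨fun h => by linear_combination h / 2, fun h => by linear_combination 2 * h⟩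
    rcases hAB with h | h
    · exact Or.inl fun x hx he => h x hx ((hiff x hx).mp he)
    · exact Or.inr fun x hx => (hiff x hx).mpr (h x hx)

end

/-! ### Passage from charts to the surface -/

theorem mfderiv_eq_fderiv_chart {S : Type*} [TopologicalSpace S] [ChartedSpace E2 S] {Φ : S → V}
    {p : S} (h : MDifferentiableAt (𝓡 2) 𝓘(ℝ, V) Φ p) :
    (mfderiv (𝓡 2) 𝓘(ℝ, V) Φ p : E2 →L[ℝ] V) =
      fderiv ℝ (Φ ∘ (chartAt E2 p).symm) (chartAt E2 p p) := by
  refine h.mfderiv.trans ?_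
  simp only [mfld_simps, fderivWithin_univ]
  rfl

end S2H2

end

open S2H2 in
theorem theorem3p7 {S : Type*} [TopologicalSpace S] [ChartedSpace S2H2.E2 S]
    [IsManifold (𝓡 2) ∞ S] (Φ : S → S2H2.V) (hPMC : S2H2.IsPMC Φ)
    (hΘ : S2H2.HopfVanishes Φ) (p : S) :
    S2H2.tangentPlane Φ p ⊓ (S2H2.tangentSphere (Φ p).1).prod ⊥ ≠ ⊥ ∨
      S2H2.tangentPlane Φ p ⊓ (⊥ : Submodule ℝ (Fin 3 → ℝ)).prod
        (S2H2.tangentHyp (Φ p).2) ≠ ⊥ := by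
  set e := chartAt E2 p with he
  have hmem : e ∈ atlas E2 S := chart_mem_atlas E2 p
  have hX : ContDiffOn ℝ ∞ (Φ ∘ e.symm) e.target :=
    contMDiffOn_iff_contDiffOn.mp
      (hPMC.smooth.comp_contMDiffOn (contMDiffOn_chart_symm (I := 𝓡 2) (x := p)))
  have hp : e p ∈ e.target := mem_chart_target E2 p
  have hS : ∀ x ∈ e.target, ((Φ ∘ e.symm) x).1 ∈ sphere := fun x _ => hPMC.mem_sphere _
  have hH : ∀ x ∈ e.target, ((Φ ∘ e.symm) x).2 ∈ hyp := fun x _ => hPMC.mem_hyp _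
  obtain ⟨w, hw, hw'⟩ := exists_tangent_factor e.open_target hX hS hH (hPMC.parallel e hmem)
    (hPMC.ne_zero e hmem) (hΘ e hmem) hp
  have hder := mfderiv_eq_fderiv_chart
    ((hPMC.smooth.contMDiffAt (x := p)).mdifferentiableAt (by simp))
  rw [← he] at hder
  have hne : fderiv ℝ (Φ ∘ e.symm) (e p) w ≠ 0 := by
    rw [← hder]
    intro h0
    exact hw (hPMC.injective_mfderiv p (h0.trans (map_zero _).symm))
  have hrange : fderiv ℝ (Φ ∘ e.symm) (e p) w ∈ tangentPlane Φ p := ⟨w, by rw [← hder]; rfl⟩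
  have t1 := tangent_fst e.open_target hX hS hp w
  have t2 := tangent_snd e.open_target hX hH hp w
  have hep : (Φ ∘ e.symm) (e p) = Φ p := by
    rw [Function.comp_apply, e.left_inv (mem_chart_source E2 p)]
  rw [hep, qf_one] at t1
  rw [hep, qf_neg_one] at t2
  -- A tangent vector with vanishing component in one factor is tangent to the other; it is nonzero
  -- because `Φ` is an immersion.
  rcases hw' with h | h
  · refine Or.inr fun hbot => hne ?_
    rw [← Submodule.mem_bot ℝ, ← hbot]
    exact ⟨hrange, h, t2⟩
  · refine Or.inl fun hbot => hne ?_
    rw [← Submodule.mem_bot ℝ, ← hbot]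
    exact ⟨hrange, t1, h⟩
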